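/- Let $\mathscr A$ be a cocomplete abelian category with exact coproducts. For a small category $\mathscr C$ let $\Delta/\mathscr C$ be its simplex category: objects are pairs $([n],f)$ with $f:[n]\to\mathscr C$ a functor, and morphisms $([n],f)\to([m],g)$ are the order preserving maps $\sigma:[n]\to[m]$ with $f=g\circ\sigma$. For a functor $T:(\Delta/\mathscr C)^{op}\to\mathscr A$ let $H_n^{Th}(\mathscr C,T)$ be the $n$-th homology of the Thomason chain complex $C_n^{Th}(\mathscr C,T)=\bigoplus_{f:[n]\to\mathscr C}T(f)$, whose differential is given on the summand of $f:[n+1]\to\mathscr C$ by $\sum_{i=0}^{n+1}(-1)^i(\delta^i)^*$, where $(\delta^i)^*:T(f)\to T(f\circ\delta^i)$ is induced by the $i$-th coface map $\delta^i:[n]\to[n+1]$. For a small category $I$ and $D:I\to\mathscr A$, let $-\,\overline\otimes_I D:\mathfrak{Fun}(I^{op},\mathfrak{Ab})\to\mathscr A$ be the symbolic tensor product, i.e. the left adjoint of $X\mapsto \mathrm{Hom}_{\mathscr A}(D(-),X)$; let $\mathrm{Tor}_n^I(-,D)$ be its $n$-th left derived functor (computed by projective resolutions in $\mathfrak{Fun}(I^{op},\mathfrak{Ab})$),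 and let $\underline{\mathbb Z}:I^{op}\to\mathfrak{Ab}$ be the constant functor with value $\mathbb Z$. Let $\mathrm{colim}_n^I$, $n\ge 0$, denote the left derived functors (left satellites) of $\mathrm{colim}^I:\mathfrak{Fun}(I,\mathscr A)\to\mathscr A$, i.e. the universal homological $\delta$-functor with $\mathrm{colim}_0^I\cong\mathrm{colim}^I$. Write $H_n(I,D)$ for $\mathrm{colim}_n^I D$. Then for every small category $\mathscr C$ the derived functors $\mathrm{colim}_n^{(\Delta/\mathscr C)^{op}}$ exist, and for all $n\ge 0$, all small categories $\mathscr C$ and all $T:(\Delta/\mathscr C)^{op}\to\mathscr A$ there are isomorphisms $$H_n^{Th}(\mathscr C,T)\;\cong\;\mathrm{Tor}_n^{(\Delta/\mathscr C)^{op}}(\underline{\mathbb Z},T)\;\cong\;\mathrm{colim}_n^{(\Delta/\mathscr C)^{op}}T\;=\;H_n((\Delta/\mathscr C)^{op},T).$$ These isomorphisms are natural in $\mathscr C$ and in $T$: they are natural transformations of functors of $T$ for fixed $\mathscr C$, and they commute with the maps induced by every pair $(\varphi,\tau)$ consisting of a functor $\varphi:\mathscr C\to\mathscr C'$ and a natural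 transformation $\tau:T\to T'\circ(\Delta/\varphi)^{op}$. -/

import Mathlib

open CategoryTheory CategoryTheory.Limits Opposite

universe v u

noncomputable section

namespace Thomason

/-! ### The simplex category of a small category -/

/-- An object `([n], f)` of the simplex category `Δ/C`: an object `[n]` of `Δ` and a functor
`f : [n] ⥤ C`, that is, an `n`-simplex of the nerve of `C`. -/
structure SimplexOver (C : Type v) [SmallCategory.{v} C] : Type v where
  /-- the object `[n]` of `Δ` -/
  dim : SimplexCategory
  /-- the functor `[n] ⥤ C` -/
  diagram : (nerve C).obj (op dim)

namespace SimplexOver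

variable {C : Type v} [SmallCategory.{v} C]

/-- A morphism `([n], f) ⟶ ([m], g)` in `Δ/C`: a morphism `σ : [n] ⟶ [m]` of `Δ`
with `f = g ∘ σ`. -/
@[ext]
structure Hom (x y : SimplexOver C) : Type v where
  /-- the underlying morphism of `Δ` -/
  toHom : x.dim ⟶ y.dim
  w : (nerve C).map toHom.op y.diagram = x.diagram

instance : SmallCategory (SimplexOver C) where
  Hom := Hom
  id x := ⟨𝟙 _, rfl⟩
  comp f g := ⟨f.toHom ≫ g.toHom, by rw [← f.w, ← g.w]; rfl⟩

/-- The morphism `([n], g ∘ σ) ⟶ ([m], g)` of `Δ/C` given by `σ : [n] ⟶ [m]`. -/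
def ofHom {a b : SimplexCategory} (σ : a ⟶ b) (g : (nerve C).obj (op b)) :
    (⟨a, (nerve C).map σ.op g⟩ : SimplexOver C) ⟶ ⟨b, g⟩ := Hom.mk σ rfl

/-- The functor `Δ/φ : Δ/C ⥤ Δ/C'`, `([n], f) ↦ ([n], φ ∘ f)`. -/
def map {C' : Type v} [SmallCategory.{v} C'] (φ : C ⥤ C') : SimplexOver C ⥤ SimplexOver C' where
  obj x := ⟨x.dim, (nerveMap φ).app (op x.dim) x.diagram⟩
  map f := Hom.mk f.toHom (by rw [← f.w]; rfl)

end SimplexOver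

/-! ### Thomason homology -/

section Homology

variable {A : Type u} [Category.{v} A] [HasColimits A]

/-- The coproduct of the `T(f)` over all `f : [n] ⥤ C`. -/
def coprodSimplices {C : Type v} [SmallCategory.{v} C] (T : (SimplexOver C)ᵒᵖ ⥤ A)
    (n : SimplexCategoryᵒᵖ) : A :=
  ∐ fun f : (nerve C).obj n => T.obj (op ⟨n.unop, f⟩)

/-- The inclusion of the summand `T(f)`. -/
def coprodSimplicesι {C : Type v} [SmallCategory.{v} C] (T : (SimplexOver C)ᵒᵖ ⥤ A)
    (n : SimplexCategoryᵒᵖ) (f : (nerve C).obj n) :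
    T.obj (op ⟨n.unop, f⟩) ⟶ coprodSimplices T n :=
  Sigma.ι (fun f : (nerve C).obj n => T.obj (op ⟨n.unop, f⟩)) f

/-- The morphism from the coproduct of the `T(f)` with given components. -/
def coprodSimplicesDesc {C : Type v} [SmallCategory.{v} C] (T : (SimplexOver C)ᵒᵖ ⥤ A)
    (n : SimplexCategoryᵒᵖ) {X : A} (p : ∀ f : (nerve C).obj n, T.obj (op ⟨n.unop, f⟩) ⟶ X) :
    coprodSimplices T n ⟶ X :=
  Sigma.desc p

@[simp]
lemma coprodSimplicesι_desc {C : Type v} [SmallCategory.{v} C] (T : (SimplexOver C)ᵒᵖ ⥤ A)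
    (n : SimplexCategoryᵒᵖ) {X : A} (p : ∀ f : (nerve C).obj n, T.obj (op ⟨n.unop, f⟩) ⟶ X)
    (f : (nerve C).obj n) : coprodSimplicesι T n f ≫ coprodSimplicesDesc T n p = p f :=
  Sigma.ι_desc _ _

@[simp]
lemma coprodSimplicesι_desc_assoc {C : Type v} [SmallCategory.{v} C] (T : (SimplexOver C)ᵒᵖ ⥤ A)
    (n : SimplexCategoryᵒᵖ) {X : A} (p : ∀ f : (nerve C).obj n, T.obj (op ⟨n.unop, f⟩) ⟶ X)
    (f : (nerve C).obj n) {Y : A} (h : X ⟶ Y) :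
    coprodSimplicesι T n f ≫ coprodSimplicesDesc T n p ≫ h = p f ≫ h := by
  rw [← Category.assoc, coprodSimplicesι_desc]

lemma coprodSimplices_hom_ext {C : Type v} [SmallCategory.{v} C] {T : (SimplexOver C)ᵒᵖ ⥤ A}
    {n : SimplexCategoryᵒᵖ} {X : A} {g h : coprodSimplices T n ⟶ X}
    (w : ∀ f, coprodSimplicesι T n f ≫ g = coprodSimplicesι T n f ≫ h) : g = h :=
  Sigma.hom_ext _ _ w

/-- The simplicial replacement `∐_* T` of a contravariant Thomason natural system
`T : (Δ/C)ᵒᵖ ⥤ A`: in degree `n` it is the coproduct of the `T(f)` over all `f : [n] ⥤ C`, and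
`σ : [m] ⟶ [n]` acts on the summand of `f` by `σ^* : T(f) ⟶ T(f ∘ σ)`. -/
def simplicialReplacementObj {C : Type v} [SmallCategory.{v} C] (T : (SimplexOver C)ᵒᵖ ⥤ A) :
    SimplicialObject A where
  obj n := coprodSimplices T n
  map {n m} σ := coprodSimplicesDesc T n fun f =>
    T.map (SimplexOver.ofHom σ.unop f).op ≫ coprodSimplicesι T m ((nerve C).map σ f)
  map_id n := coprodSimplices_hom_ext fun f => by
    rw [coprodSimplicesι_desc, Category.comp_id]
    exact (congrArg (· ≫ coprodSimplicesι T n f) (T.map_id _)).trans (Category.id_comp _)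
  map_comp {n m k} σ τ := coprodSimplices_hom_ext fun f => by
    rw [coprodSimplicesι_desc, coprodSimplicesι_desc_assoc, Category.assoc, coprodSimplicesι_desc,
      ← T.map_comp_assoc]
    rfl

/-- The component `τ_f : T(f) ⟶ T'(φ ∘ f)` of a natural transformation `τ : T ⟶ T' ∘ Δ/φ`. -/
def simplexComponent {C C' : Type v} [SmallCategory.{v} C] [SmallCategory.{v} C']
    (φ : C ⥤ C') {T : (SimplexOver C)ᵒᵖ ⥤ A} {T' : (SimplexOver C')ᵒᵖ ⥤ A}
    (τ : T ⟶ (SimplexOver.map φ).op ⋙ T') (n : SimplexCategoryᵒᵖ) (f : (nerve C).obj n) :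
    T.obj (op ⟨n.unop, f⟩) ⟶ T'.obj (op ⟨n.unop, (nerveMap φ).app n f⟩) :=
  τ.app (op ⟨n.unop, f⟩)

/-- The map of simplicial replacements induced by a functor `φ : C ⥤ C'` and a natural
transformation `τ : T ⟶ T' ∘ Δ/φ`: the summand of `f` goes to the summand of `φ ∘ f` by `τ_f`. -/
def simplicialReplacementMap {C C' : Type v} [SmallCategory.{v} C] [SmallCategory.{v} C']
    (φ : C ⥤ C') {T : (SimplexOver C)ᵒᵖ ⥤ A} {T' : (SimplexOver C')ᵒᵖ ⥤ A}
    (τ : T ⟶ (SimplexOver.map φ).op ⋙ T') :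
    simplicialReplacementObj T ⟶ simplicialReplacementObj T' where
  app n := coprodSimplicesDesc T n fun f =>
    simplexComponent φ τ n f ≫ coprodSimplicesι T' n ((nerveMap φ).app n f)
  naturality {n m} σ := coprodSimplices_hom_ext fun f => by
    simp only [simplicialReplacementObj]
    rw [coprodSimplicesι_desc_assoc, Category.assoc, coprodSimplicesι_desc,
      coprodSimplicesι_desc_assoc, Category.assoc, coprodSimplicesι_desc]
    exact (τ.naturality_assoc (SimplexOver.ofHom σ.unop f).op
      (coprodSimplicesι T' m ((nerveMap φ).app m ((nerve C).map σ f))))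

/-- The map of simplicial replacements induced by a morphism of Thomason natural systems on a
fixed category: on the summand of `f` it is `τ_f : T(f) ⟶ T'(f)`. -/
def simplicialReplacementHom {C : Type v} [SmallCategory.{v} C] {T T' : (SimplexOver C)ᵒᵖ ⥤ A}
    (τ : T ⟶ T') : simplicialReplacementObj T ⟶ simplicialReplacementObj T' where
  app n := coprodSimplicesDesc T n fun f => τ.app (op ⟨n.unop, f⟩) ≫ coprodSimplicesι T' n f
  naturality {n m} σ := coprodSimplices_hom_ext fun f => by simp [simplicialReplacementObj]

/-- The simplicial replacement as a functor of the Thomason natural system. -/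
def simplicialReplacement (A : Type u) [Category.{v} A] [HasColimits A]
    (C : Type v) [SmallCategory.{v} C] :
    ((SimplexOver C)ᵒᵖ ⥤ A) ⥤ SimplicialObject A where
  obj T := simplicialReplacementObj T
  map τ := simplicialReplacementHom τ
  map_id T := by
    ext n
    refine coprodSimplices_hom_ext fun f => (coprodSimplicesι_desc _ _ _ _).trans ?_
    exact (Category.id_comp _).trans (Category.comp_id _).symm
  map_comp {T T' T''} τ τ' := by
    ext n
    refine coprodSimplices_hom_ext fun f => (coprodSimplicesι_desc _ _ _ _).trans ?_
    refine Eq.trans ?_ (coprodSimplicesι_desc_assoc T n _ f _).symm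
    refine Eq.trans ?_ (Category.assoc _ _ _).symm
    refine Eq.trans ?_ (_ ≫= (coprodSimplicesι_desc T' n _ f).symm)
    exact Category.assoc _ _ _

/-- The Thomason chain complex `C_*^{Th}(C, T)`: in degree `n` it is `∐_{f : [n] ⥤ C} T(f)`, and the
differential is the alternating sum of the maps induced by the cofaces `δ^i`. -/
def thomasonComplex (A : Type u) [Category.{v} A] [Abelian A] [HasColimits A]
    (C : Type v) [SmallCategory.{v} C] : ((SimplexOver C)ᵒᵖ ⥤ A) ⥤ ChainComplex A ℕ :=
  simplicialReplacement A C ⋙ AlgebraicTopology.alternatingFaceMapComplex A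

/-- Thomason homology `H_n^{Th}(C, -)`. -/
def thomasonHomology (A : Type u) [Category.{v} A] [Abelian A] [HasColimits A]
    (C : Type v) [SmallCategory.{v} C] (n : ℕ) : ((SimplexOver C)ᵒᵖ ⥤ A) ⥤ A :=
  thomasonComplex A C ⋙ HomologicalComplex.homologyFunctor A _ n

/-- The map `H_n^{Th}(C, T) ⟶ H_n^{Th}(C', T')` induced by a functor `φ : C ⥤ C'` and a natural
transformation `τ : T ⟶ T' ∘ Δ/φ`. -/
def thomasonHomologyMap {A : Type u} [Category.{v} A] [Abelian A] [HasColimits A]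
    {C C' : Type v} [SmallCategory.{v} C] [SmallCategory.{v} C']
    (φ : C ⥤ C') {T : (SimplexOver C)ᵒᵖ ⥤ A} {T' : (SimplexOver C')ᵒᵖ ⥤ A}
    (τ : T ⟶ (SimplexOver.map φ).op ⋙ T') (n : ℕ) :
    (thomasonHomology A C n).obj T ⟶ (thomasonHomology A C' n).obj T' :=
  (HomologicalComplex.homologyFunctor A _ n).map
    ((AlgebraicTopology.alternatingFaceMapComplex A).map
      (X := simplicialReplacementObj T) (Y := simplicialReplacementObj T')
      (simplicialReplacementMap φ τ))

end Homology

/-! ### The symbolic tensor product -/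

section Tensor

variable {I : Type v} [SmallCategory.{v} I] {A : Type u} [Category.{v} A] [Abelian A]

/-- The functor `A ⥤ Fun(Iᵒᵖ, Ab)`, `X ↦ Hom_A(D(-), X)`. -/
def homFunctor (D : I ⥤ A) : A ⥤ (Iᵒᵖ ⥤ AddCommGrpCat.{v}) :=
  preadditiveYoneda ⋙ (Functor.whiskeringLeft _ _ _).obj D.op

instance (D : I ⥤ A) : (homFunctor D).Additive where
  map_add {X Y f g} := by
    ext i x
    exact Preadditive.comp_add _ _ _ x f g

variable [HasColimits A]

/-- The index set of the relations in the presentation of `F ⊗_I D` by the generators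
`x ⊗ D(i)`, `x ∈ F(i)`: compatibility with the morphisms of `I`, and additivity in `x`. -/
abbrev TensorRel (F : Iᵒᵖ ⥤ AddCommGrpCat.{v}) : Type v :=
  (Σ (i j : I) (_ : i ⟶ j), F.obj (op j)) ⊕ (Σ i : I, F.obj (op i) × F.obj (op i))

/-- The coproduct of the generators of `F ⊗_I D`. -/
abbrev tensorGen (F : Iᵒᵖ ⥤ AddCommGrpCat.{v}) (D : I ⥤ A) : A :=
  ∐ fun p : Σ i : I, F.obj (op i) => D.obj p.1

/-- The morphism out of the coproduct of the generators with given components. -/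
abbrev tensorGenDesc (F : Iᵒᵖ ⥤ AddCommGrpCat.{v}) (D : I ⥤ A) {X : A}
    (p : ∀ (i : I), F.obj (op i) → (D.obj i ⟶ X)) : tensorGen F D ⟶ X :=
  Sigma.desc fun q => p q.1 q.2

/-- The inclusion of the generator `x ⊗ D(i)`. -/
abbrev tensorGenι (F : Iᵒᵖ ⥤ AddCommGrpCat.{v}) (D : I ⥤ A) (i : I) (x : F.obj (op i)) :
    D.obj i ⟶ tensorGen F D :=
  Sigma.ι (fun p : Σ i : I, F.obj (op i) => D.obj p.1) ⟨i, x⟩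

/-- The object of `A` on which a relation lives. -/
abbrev tensorRelObj (F : Iᵒᵖ ⥤ AddCommGrpCat.{v}) (D : I ⥤ A) : TensorRel F → A
  | .inl r => D.obj r.1
  | .inr r => D.obj r.1

/-- The relations `F(u)(x) ⊗ a = x ⊗ D(u)(a)` and `(x + y) ⊗ a = x ⊗ a + y ⊗ a`. -/
def tensorRelMap (F : Iᵒᵖ ⥤ AddCommGrpCat.{v}) (D : I ⥤ A) :
    (∐ tensorRelObj F D) ⟶ tensorGen F D :=
  Sigma.desc fun
    | .inl ⟨i, j, t, x⟩ => tensorGenι F D i (F.map t.op x) - D.map t ≫ tensorGenι F D j x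
    | .inr ⟨i, x, y⟩ => tensorGenι F D i (x + y) - (tensorGenι F D i x + tensorGenι F D i y)

/-- The object `F ⊗_I D`. -/
abbrev tensorObj (D : I ⥤ A) (F : Iᵒᵖ ⥤ AddCommGrpCat.{v}) : A :=
  cokernel (tensorRelMap F D)

/-- The inclusion of the generator `x ⊗ D(i)` in `F ⊗_I D`. -/
def tensorι (D : I ⥤ A) (F : Iᵒᵖ ⥤ AddCommGrpCat.{v}) (i : I) (x : F.obj (op i)) :
    D.obj i ⟶ tensorObj D F :=
  tensorGenι F D i x ≫ cokernel.π _

lemma tensorι_map (D : I ⥤ A) (F : Iᵒᵖ ⥤ AddCommGrpCat.{v}) {i j : I} (t : i ⟶ j)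
    (x : F.obj (op j)) : tensorι D F i (F.map t.op x) = D.map t ≫ tensorι D F j x := by
  have h := Sigma.ι (tensorRelObj F D) (.inl ⟨i, j, t, x⟩) ≫= cokernel.condition (tensorRelMap F D)
  rw [comp_zero, tensorRelMap, Sigma.ι_desc_assoc, Preadditive.sub_comp, sub_eq_zero,
    Category.assoc] at h
  exact h

lemma tensorι_add (D : I ⥤ A) (F : Iᵒᵖ ⥤ AddCommGrpCat.{v}) (i : I)
    (x y : F.obj (op i)) : tensorι D F i (x + y) = tensorι D F i x + tensorι D F i y := by
  have h := Sigma.ι (tensorRelObj F D) (.inr ⟨i, x, y⟩) ≫= cokernel.condition (tensorRelMap F D)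
  rw [comp_zero, tensorRelMap, Sigma.ι_desc_assoc, Preadditive.sub_comp, sub_eq_zero,
    Preadditive.add_comp] at h
  exact h

/-- The morphism out of `F ⊗_I D` with given components. -/
def tensorDesc (D : I ⥤ A) (F : Iᵒᵖ ⥤ AddCommGrpCat.{v}) {X : A}
    (p : ∀ (i : I), F.obj (op i) → (D.obj i ⟶ X))
    (h₁ : ∀ (i j : I) (t : i ⟶ j) (x : F.obj (op j)), p i (F.map t.op x) = D.map t ≫ p j x)
    (h₂ : ∀ (i : I) (x y : F.obj (op i)), p i (x + y) = p i x + p i y) : tensorObj D F ⟶ X :=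
  cokernel.desc _ (tensorGenDesc F D p) (by
    refine Sigma.hom_ext _ _ ?_
    rintro (⟨i, j, t, x⟩ | ⟨i, x, y⟩)
    · rw [tensorRelMap, Sigma.ι_desc_assoc, comp_zero, Preadditive.sub_comp, sub_eq_zero,
        Category.assoc, Sigma.ι_desc, Sigma.ι_desc]
      exact h₁ i j t x
    · rw [tensorRelMap, Sigma.ι_desc_assoc, comp_zero, Preadditive.sub_comp, sub_eq_zero,
        Preadditive.add_comp, Sigma.ι_desc, Sigma.ι_desc, Sigma.ι_desc]
      exact h₂ i x y)

lemma tensorι_desc (D : I ⥤ A) (F : Iᵒᵖ ⥤ AddCommGrpCat.{v}) {X : A}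
    (p : ∀ (i : I), F.obj (op i) → (D.obj i ⟶ X)) (h₁ h₂) (i : I) (x : F.obj (op i)) :
    tensorι D F i x ≫ tensorDesc D F p h₁ h₂ = p i x := by
  rw [tensorι, tensorDesc, Category.assoc, cokernel.π_desc, Sigma.ι_desc]

lemma tensorObj_hom_ext {D : I ⥤ A} {F : Iᵒᵖ ⥤ AddCommGrpCat.{v}} {X : A}
    {f g : tensorObj D F ⟶ X} (h : ∀ i x, tensorι D F i x ≫ f = tensorι D F i x ≫ g) : f = g := by
  rw [← cancel_epi (cokernel.π (tensorRelMap F D))]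
  refine Sigma.hom_ext _ _ fun ⟨i, x⟩ => ?_
  exact (Category.assoc _ _ _).symm.trans ((h i x).trans (Category.assoc _ _ _))

/-- The bijection `Hom_A(F ⊗_I D, X) ≃ Hom(F, Hom_A(D(-), X))`. -/
def tensorHomEquiv (D : I ⥤ A) (F : Iᵒᵖ ⥤ AddCommGrpCat.{v}) (X : A) :
    (tensorObj D F ⟶ X) ≃ (F ⟶ (homFunctor D).obj X) where
  toFun f :=
    { app i := AddCommGrpCat.ofHom (AddMonoidHom.mk' (fun x => tensorι D F i.unop x ≫ f)
        fun x y => by rw [tensorι_add]; exact Preadditive.add_comp _ _ _ _ _ _)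
      naturality i j t := by
        ext x
        change tensorι D F j.unop (F.map t.unop.op x) ≫ f = D.map t.unop ≫ tensorι D F i.unop x ≫ f
        rw [tensorι_map, Category.assoc] }
  invFun α := tensorDesc D F (fun i x => (α.app (op i)).hom x)
    (fun i j t x => ConcreteCategory.congr_hom (α.naturality t.op) x)
    (fun i x y => (α.app (op i)).hom.map_add x y)
  left_inv f := tensorObj_hom_ext fun i x => tensorι_desc _ _ _ _ _ _ _
  right_inv α := by
    ext i x
    exact tensorι_desc D F (fun i x => (α.app (op i)).hom x) _ _ _ _

lemma tensorι_homEquiv_symm {D : I ⥤ A} {F : Iᵒᵖ ⥤ AddCommGrpCat.{v}} {X : A}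
    (α : F ⟶ (homFunctor D).obj X) (i : I) (x : F.obj (op i)) :
    tensorι D F i x ≫ (tensorHomEquiv D F X).symm α = (α.app (op i)).hom x := by
  apply tensorι_desc
  · exact fun i j t x => ConcreteCategory.congr_hom (α.naturality t.op) x
  · exact fun i x y => (α.app (op i)).hom.map_add x y

/-- The map `F ⊗_I D ⟶ G ⊗_I D` induced by `f : F ⟶ G`; it sends `x ⊗ a` to `f(x) ⊗ a`. -/
def tensorMapLeft (D : I ⥤ A) {F G : Iᵒᵖ ⥤ AddCommGrpCat.{v}} (f : F ⟶ G) :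
    tensorObj D F ⟶ tensorObj D G :=
  tensorDesc D F (fun i x => tensorι D G i (f.app (op i) x))
    (fun i j t x => by rw [← tensorι_map, ← NatTrans.naturality_apply])
    (fun i x y => by rw [map_add, tensorι_add])

lemma tensorι_mapLeft (D : I ⥤ A) {F G : Iᵒᵖ ⥤ AddCommGrpCat.{v}} (f : F ⟶ G)
    (i : I) (x : F.obj (op i)) :
    tensorι D F i x ≫ tensorMapLeft D f = tensorι D G i (f.app (op i) x) :=
  tensorι_desc _ _ _ _ _ _ _

lemma tensorι_mapLeft_assoc (D : I ⥤ A) {F G : Iᵒᵖ ⥤ AddCommGrpCat.{v}} (f : F ⟶ G)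
    (i : I) (x : F.obj (op i)) {X : A} (h : tensorObj D G ⟶ X) :
    tensorι D F i x ≫ tensorMapLeft D f ≫ h = tensorι D G i (f.app (op i) x) ≫ h := by
  rw [← Category.assoc, tensorι_mapLeft]

/-- The map `F ⊗_I D ⟶ F ⊗_I E` induced by `τ : D ⟶ E`; it sends `x ⊗ a` to `x ⊗ τ(a)`. -/
def tensorMapRight {D E : I ⥤ A} (τ : D ⟶ E) (F : Iᵒᵖ ⥤ AddCommGrpCat.{v}) :
    tensorObj D F ⟶ tensorObj E F :=
  tensorDesc D F (fun i x => τ.app i ≫ tensorι E F i x)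
    (fun i j t x => by rw [tensorι_map, τ.naturality_assoc])
    (fun i x y => by rw [tensorι_add, Preadditive.comp_add])

lemma tensorι_mapRight {D E : I ⥤ A} (τ : D ⟶ E) (F : Iᵒᵖ ⥤ AddCommGrpCat.{v})
    (i : I) (x : F.obj (op i)) :
    tensorι D F i x ≫ tensorMapRight τ F = τ.app i ≫ tensorι E F i x :=
  tensorι_desc _ _ _ _ _ _ _

lemma tensorι_mapRight_assoc {D E : I ⥤ A} (τ : D ⟶ E) (F : Iᵒᵖ ⥤ AddCommGrpCat.{v})
    (i : I) (x : F.obj (op i)) {X : A} (h : tensorObj E F ⟶ X) :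
    tensorι D F i x ≫ tensorMapRight τ F ≫ h = τ.app i ≫ tensorι E F i x ≫ h := by
  rw [← Category.assoc, tensorι_mapRight, Category.assoc]

/-- The symbolic tensor product `- ⊗_I D : Fun(Iᵒᵖ, Ab) ⥤ A`. -/
def symbolicTensor (D : I ⥤ A) : (Iᵒᵖ ⥤ AddCommGrpCat.{v}) ⥤ A where
  obj F := tensorObj D F
  map f := tensorMapLeft D f
  map_id F := tensorObj_hom_ext fun i x => by
    rw [tensorι_mapLeft, Category.comp_id]
    rfl
  map_comp f g := tensorObj_hom_ext fun i x => by
    rw [tensorι_mapLeft, tensorι_mapLeft_assoc, tensorι_mapLeft]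
    rfl

/-- The symbolic tensor product `- ⊗_I D` is left adjoint to `X ↦ Hom_A(D(-), X)`. -/
def symbolicTensorAdj (D : I ⥤ A) : symbolicTensor D ⊣ homFunctor D :=
  Adjunction.mkOfHomEquiv
    { homEquiv := tensorHomEquiv D
      homEquiv_naturality_left_symm {F G X} f g := tensorObj_hom_ext fun i x => by
        refine (tensorι_homEquiv_symm (f ≫ g) i x).trans ?_
        refine Eq.trans ?_ (tensorι_mapLeft_assoc D f i x _).symm
        exact (tensorι_homEquiv_symm g i (f.app (op i) x)).symm
      homEquiv_naturality_right {F X Y} f g := by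
        ext i x
        exact (Category.assoc _ _ _).symm }

instance (D : I ⥤ A) : (symbolicTensor D).Additive :=
  (symbolicTensorAdj D).left_adjoint_additive

/-- The natural transformation `- ⊗_I D ⟶ - ⊗_I E` induced by `τ : D ⟶ E`. -/
def symbolicTensorHom {D E : I ⥤ A} (τ : D ⟶ E) : symbolicTensor D ⟶ symbolicTensor E where
  app F := tensorMapRight τ F
  naturality {F G} f := tensorObj_hom_ext fun i x => by
    change tensorι D F i x ≫ tensorMapLeft D f ≫ tensorMapRight τ G =
      tensorι D F i x ≫ tensorMapRight τ F ≫ tensorMapLeft E f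
    rw [tensorι_mapLeft_assoc, tensorι_mapRight, tensorι_mapRight_assoc, tensorι_mapLeft]

lemma symbolicTensorHom_id (D : I ⥤ A) : symbolicTensorHom (𝟙 D) = 𝟙 (symbolicTensor D) := by
  ext F
  refine tensorObj_hom_ext fun i x => (tensorι_mapRight _ _ _ _).trans ?_
  exact (Category.id_comp _).trans (Category.comp_id _).symm

lemma symbolicTensorHom_comp {D E E' : I ⥤ A} (τ : D ⟶ E) (τ' : E ⟶ E') :
    symbolicTensorHom (τ ≫ τ') = symbolicTensorHom τ ≫ symbolicTensorHom τ' := by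
  ext F
  refine tensorObj_hom_ext fun i x => (tensorι_mapRight _ _ _ _).trans ?_
  change _ = tensorι D F i x ≫ tensorMapRight τ F ≫ tensorMapRight τ' F
  rw [tensorι_mapRight_assoc, tensorι_mapRight, NatTrans.comp_app, Category.assoc]

/-- The restriction functor `Fun(Kᵒᵖ, Ab) ⥤ Fun(Iᵒᵖ, Ab)` along `w : I ⥤ K`. -/
abbrev restrictAb {K : Type v} [SmallCategory.{v} K] (w : I ⥤ K) :
    (Kᵒᵖ ⥤ AddCommGrpCat.{v}) ⥤ (Iᵒᵖ ⥤ AddCommGrpCat.{v}) :=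
  (Functor.whiskeringLeft _ _ _).obj w.op

/-- The map `(F ∘ w) ⊗_I D ⟶ F ⊗_K E` induced by `w : I ⥤ K` and `τ : D ⟶ E ∘ w`;
it sends `x ⊗ a` to `x ⊗ τ(a)`. -/
def tensorChange {K : Type v} [SmallCategory.{v} K] (w : I ⥤ K) {D : I ⥤ A} {E : K ⥤ A}
    (τ : D ⟶ w ⋙ E) (F : Kᵒᵖ ⥤ AddCommGrpCat.{v}) :
    tensorObj D (w.op ⋙ F) ⟶ tensorObj E F :=
  tensorDesc D (w.op ⋙ F) (fun i x => τ.app i ≫ tensorι E F (w.obj i) x)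
    (fun _ j t x => (_ ≫= tensorι_map E F (w.map t) x).trans
      (τ.naturality_assoc t (tensorι E F (w.obj j) x)).symm)
    (fun i x y => (_ ≫= tensorι_add E F (w.obj i) x y).trans (Preadditive.comp_add _ _ _ _ _ _))

lemma tensorι_change {K : Type v} [SmallCategory.{v} K] (w : I ⥤ K) {D : I ⥤ A} {E : K ⥤ A}
    (τ : D ⟶ w ⋙ E) (F : Kᵒᵖ ⥤ AddCommGrpCat.{v}) (i : I) (x : F.obj (op (w.obj i))) :
    tensorι D (w.op ⋙ F) i x ≫ tensorChange w τ F = τ.app i ≫ tensorι E F (w.obj i) x :=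
  tensorι_desc _ _ _ _ _ _ _

lemma tensorι_change_assoc {K : Type v} [SmallCategory.{v} K] (w : I ⥤ K) {D : I ⥤ A} {E : K ⥤ A}
    (τ : D ⟶ w ⋙ E) (F : Kᵒᵖ ⥤ AddCommGrpCat.{v}) (i : I) (x : F.obj (op (w.obj i)))
    {X : A} (h : tensorObj E F ⟶ X) :
    tensorι D (w.op ⋙ F) i x ≫ tensorChange w τ F ≫ h = τ.app i ≫ tensorι E F (w.obj i) x ≫ h := by
  rw [← Category.assoc, tensorι_change, Category.assoc]

/-- The natural transformation `(- ∘ w) ⊗_I D ⟶ - ⊗_K E` induced by `w : I ⥤ K` and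
`τ : D ⟶ E ∘ w`. -/
def symbolicTensorChange {K : Type v} [SmallCategory.{v} K] (w : I ⥤ K) {D : I ⥤ A} {E : K ⥤ A}
    (τ : D ⟶ w ⋙ E) : restrictAb w ⋙ symbolicTensor D ⟶ symbolicTensor E where
  app F := tensorChange w τ F
  naturality {F G} f := tensorObj_hom_ext fun i x => by
    refine (tensorι_mapLeft_assoc D ((restrictAb w).map f) i x (tensorChange w τ G)).trans ?_
    refine (tensorι_change w τ G i _).trans ?_
    refine Eq.trans ?_ (tensorι_change_assoc w τ F i x (tensorMapLeft E f)).symm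
    exact _ ≫= (tensorι_mapLeft E f (w.obj i) x).symm

end Tensor

/-! ### Projective resolutions in categories of diagrams of abelian groups -/

section Projectives

variable {J : Type v} [SmallCategory.{v} J]

/-- The functor `ℤ Hom_J(j, -)`. -/
abbrev freeRep (j : J) : J ⥤ AddCommGrpCat.{v} := coyoneda.obj (op j) ⋙ AddCommGrpCat.free

/-- Morphisms from `ℤ Hom_J(j, -)` to `F` are the elements of `F(j)`. -/
def freeRepEquiv (j : J) (F : J ⥤ AddCommGrpCat.{v}) : (freeRep j ⟶ F) ≃ F.obj j :=
  ((AddCommGrpCat.adj.whiskerRight J).homEquiv (coyoneda.obj (op j)) F).trans coyonedaEquiv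

lemma freeRepEquiv_comp (j : J) {F G : J ⥤ AddCommGrpCat.{v}} (f : freeRep j ⟶ F) (g : F ⟶ G) :
    freeRepEquiv j G (f ≫ g) = g.app j (freeRepEquiv j F f) := by
  simp only [freeRepEquiv, Equiv.trans_apply]
  erw [Adjunction.homEquiv_naturality_right]
  rfl

lemma freeRepEquiv_apply (j : J) {F : J ⥤ AddCommGrpCat.{v}} (f : freeRep j ⟶ F) :
    ∃ a : (freeRep j).obj j, f.app j a = freeRepEquiv j F f :=
  ⟨freeRepEquiv j _ (𝟙 _), by rw [← freeRepEquiv_comp, Category.id_comp]⟩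

instance (j : J) : Projective (freeRep j) where
  factors {F G} f e he := by
    have : Epi (e.app j) := inferInstance
    obtain ⟨y, hy⟩ := (AddCommGrpCat.epi_iff_surjective _).1 this (freeRepEquiv j _ f)
    refine ⟨(freeRepEquiv j _).symm y, (freeRepEquiv j _).injective ?_⟩
    rw [freeRepEquiv_comp, Equiv.apply_symm_apply, hy]

instance : EnoughProjectives (J ⥤ AddCommGrpCat.{v}) where
  presentation F := ⟨{
    p := ∐ fun q : Σ j : J, F.obj j => freeRep q.1
    projective := inferInstance
    f := Sigma.desc fun q => (freeRepEquiv q.1 F).symm q.2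
    epi := by
      refine @NatTrans.epi_of_epi_app _ _ _ _ _ _ _ fun j => ?_
      rw [AddCommGrpCat.epi_iff_surjective]
      intro y
      obtain ⟨a, ha⟩ := freeRepEquiv_apply j ((freeRepEquiv j F).symm y)
      refine ⟨(Sigma.ι (fun q : Σ j : J, F.obj j => freeRep q.1) ⟨j, y⟩).app j a, ?_⟩
      rw [Equiv.apply_symm_apply] at ha
      rw [← ConcreteCategory.comp_apply, ← NatTrans.comp_app, Sigma.ι_desc]
      exact ha }⟩

end Projectives

/-! ### Tor -/

section Tor

variable {A : Type u} [Category.{v} A] [Abelian A] [HasColimits A]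
variable {I : Type v} [SmallCategory.{v} I]

/-- `Tor_n^I(-, D)`, the `n`-th left derived functor of `- ⊗_I D : Fun(Iᵒᵖ, Ab) ⥤ A`. -/
def Tor (D : I ⥤ A) (n : ℕ) : (Iᵒᵖ ⥤ AddCommGrpCat.{v}) ⥤ A :=
  (symbolicTensor D).leftDerived n

/-- The constant functor `ℤ : Iᵒᵖ ⥤ Ab`. -/
def constZ (I : Type v) [SmallCategory.{v} I] : Iᵒᵖ ⥤ AddCommGrpCat.{v} :=
  (Functor.const _).obj (AddCommGrpCat.of (ULift.{v} ℤ))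

/-- The functor `Tor_n^I(ℤ, -) : Fun(I, A) ⥤ A`. -/
def torZ (A : Type u) [Category.{v} A] [Abelian A] [HasColimits A] (I : Type v)
    [SmallCategory.{v} I] (n : ℕ) : (I ⥤ A) ⥤ A where
  obj D := (Tor D n).obj (constZ I)
  map τ := (NatTrans.leftDerived (symbolicTensorHom τ) n).app (constZ I)
  map_id D := by
    rw [symbolicTensorHom_id, NatTrans.leftDerived_id]
    rfl
  map_comp τ τ' := by
    rw [symbolicTensorHom_comp, NatTrans.leftDerived_comp]
    rfl

end Tor

/-! ### Maps between left derived functors along an exact functor -/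

section DerivedChange

universe v₁ v₂ v₃ u₁ u₂ u₃

variable {B : Type u₁} [Category.{v₁} B] [Abelian B] {B' : Type u₂} [Category.{v₂} B'] [Abelian B']
  {A : Type u₃} [Category.{v₃} A] [Abelian A]

/-- The comparison lemma: a morphism lifts to a chain map from an augmented complex of projective
objects to an exact augmented complex. -/
lemma exists_chain_lift {K L : ChainComplex B ℕ} (hK : ∀ n, Projective (K.X n)) {Y W : B}
    (p : K.X 0 ⟶ Y) (hp : K.d 1 0 ≫ p = 0) (q : L.X 0 ⟶ W) (hq : L.d 1 0 ≫ q = 0) (_ : Epi q)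
    (h₀ : (ShortComplex.mk _ _ hq).Exact)
    (hs : ∀ n, (ShortComplex.mk _ _ (L.d_comp_d (n + 2) (n + 1) n)).Exact) (f : Y ⟶ W) :
    ∃ l : K ⟶ L, l.f 0 ≫ q = p ≫ f := by
  obtain ⟨l0, h_l0⟩ : ∃ l0 : K.X 0 ⟶ L.X 0, l0 ≫ q = p ≫ f :=
    ⟨Projective.factorThru (p ≫ f) q, Projective.factorThru_comp _ _⟩
  have e0 : (K.d 1 0 ≫ l0) ≫ q = 0 := by
    rw [Category.assoc, h_l0, reassoc_of% hp, zero_comp]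
  have es : ∀ (n : ℕ) (g : K.X n ⟶ L.X n) (g' : K.X (n + 1) ⟶ L.X (n + 1))
      (_ : g' ≫ L.d (n + 1) n = K.d (n + 1) n ≫ g),
      (K.d (n + 2) (n + 1) ≫ g') ≫ L.d (n + 1) n = 0 := by
    intro n g g' h
    rw [Category.assoc, h, K.d_comp_d_assoc, zero_comp]
  refine ⟨ChainComplex.mkHom _ _ l0 (h₀.liftFromProjective (K.d 1 0 ≫ l0) e0)
    (h₀.liftFromProjective_comp _ e0) (fun n r =>
      ⟨(hs n).liftFromProjective (K.d (n + 2) (n + 1) ≫ r.2.1) (es n _ _ r.2.2),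
        (hs n).liftFromProjective_comp _ (es n _ _ r.2.2)⟩), ?_⟩
  rw [ChainComplex.mkHom_f_0, h_l0]

/-- A morphism `f : Y ⟶ R(Z)` lifts to a chain map `P ⟶ R(Q)`, where `P` and `Q` are projective
resolutions of `Y` and `Z` and `R` is an exact functor. -/
lemma exists_resolution_lift (R : B' ⥤ B) [R.Additive] [PreservesFiniteLimits R]
    [PreservesFiniteColimits R] {Y : B} {Z : B'} (P : ProjectiveResolution Y)
    (Q : ProjectiveResolution Z) (f : Y ⟶ R.obj Z) :
    ∃ l : P.complex ⟶ (R.mapHomologicalComplex _).obj Q.complex,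
      l.f 0 ≫ R.map (Q.π.f 0) = P.π.f 0 ≫ f :=
  have _ : Epi (Q.π.f 0) := inferInstance
  exists_chain_lift (L := (R.mapHomologicalComplex _).obj Q.complex) P.projective (P.π.f 0)
    P.complex_d_comp_π_f_zero (R.map (Q.π.f 0)) _ (R.map_epi (Q.π.f 0)) (Q.exact₀.map R)
    (fun n => (Q.exact_succ n).map R) f

variable [EnoughProjectives B] [EnoughProjectives B']

/-- The chain map `F(R(K)) ⟶ F'(K)` induced by `α : F ∘ R ⟶ F'`. -/
def complexChange {R : B' ⥤ B} [R.Additive] {F : B ⥤ A} [F.Additive] {F' : B' ⥤ A} [F'.Additive]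
    (α : R ⋙ F ⟶ F') (K : ChainComplex B' ℕ) :
    (F.mapHomologicalComplex _).obj ((R.mapHomologicalComplex _).obj K) ⟶
      (F'.mapHomologicalComplex _).obj K where
  f n := α.app (K.X n)
  comm' i j _ := (α.naturality (K.d i j)).symm

/-- Let `R` be an exact functor, `α : F ∘ R ⟶ F'` a natural transformation between additive
functors, and `f : Y ⟶ R(Z)` a morphism. This is the induced map `(L_n F)(Y) ⟶ (L_n F')(Z)`,
computed by a chain map `P ⟶ R(Q)` lifting `f` between projective resolutions of `Y` and `Z`. -/
def leftDerivedChange {R : B' ⥤ B} [R.Additive] [PreservesFiniteLimits R]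
    [PreservesFiniteColimits R] {F : B ⥤ A} [F.Additive] {F' : B' ⥤ A} [F'.Additive]
    (α : R ⋙ F ⟶ F') {Y : B} {Z : B'} (f : Y ⟶ R.obj Z) (n : ℕ) :
    (F.leftDerived n).obj Y ⟶ (F'.leftDerived n).obj Z :=
  ((projectiveResolution Y).isoLeftDerivedObj F n).hom ≫
    (HomologicalComplex.homologyFunctor A _ n).map
      ((F.mapHomologicalComplex _).map (exists_resolution_lift R (projectiveResolution Y)
          (projectiveResolution Z) f).choose ≫
        complexChange α (projectiveResolution Z).complex) ≫
    ((projectiveResolution Z).isoLeftDerivedObj F' n).inv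

end DerivedChange

/-- The map `Tor_n^I(ℤ, D) ⟶ Tor_n^K(ℤ, E)` induced by a functor `w : I ⥤ K` and a natural
transformation `τ : D ⟶ E ∘ w`. -/
def torZMap {A : Type u} [Category.{v} A] [Abelian A] [HasColimits A]
    {I K : Type v} [SmallCategory.{v} I] [SmallCategory.{v} K] (w : I ⥤ K) {D : I ⥤ A} {E : K ⥤ A}
    (τ : D ⟶ w ⋙ E) (n : ℕ) : (torZ A I n).obj D ⟶ (torZ A K n).obj E :=
  leftDerivedChange (symbolicTensorChange w τ) (Y := constZ I) (Z := constZ K)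
    { app _ := 𝟙 _ } n

/-! ### Homological δ-functors and left derived functors -/

section DeltaFunctor

universe v₁ v₂ v₃ u₁ u₂ u₃

/-- A homological `δ`-functor `(T_n)_{n ≥ 0}` between abelian categories: additive functors `T_n`
and natural connecting morphisms which turn each short exact sequence
`0 ⟶ X₁ ⟶ X₂ ⟶ X₃ ⟶ 0` into a long exact sequence
`⋯ ⟶ T_{n+1}(X₃) ⟶ T_n(X₁) ⟶ T_n(X₂) ⟶ T_n(X₃) ⟶ ⋯ ⟶ T_0(X₃) ⟶ 0`. -/
structure HomologicalDeltaFunctor (B : Type u₁) [Category.{v₁} B] [Abelian B]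
    (A : Type u₂) [Category.{v₂} A] [Abelian A] where
  /-- the functors `T_n` -/
  functor : ℕ → B ⥤ A
  additive (n : ℕ) : (functor n).Additive
  /-- the connecting morphism `T_{n+1}(X₃) ⟶ T_n(X₁)` -/
  δ (S : ShortComplex B) (hS : S.ShortExact) (n : ℕ) :
    (functor (n + 1)).obj S.X₃ ⟶ (functor n).obj S.X₁
  δ_naturality {S S' : ShortComplex B} (hS : S.ShortExact) (hS' : S'.ShortExact) (f : S ⟶ S')
    (n : ℕ) : δ S hS n ≫ (functor n).map f.τ₁ = (functor (n + 1)).map f.τ₃ ≫ δ S' hS' n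
  δ_comp (S : ShortComplex B) (hS : S.ShortExact) (n : ℕ) : δ S hS n ≫ (functor n).map S.f = 0
  map_comp_map (S : ShortComplex B) (_ : S.ShortExact) (n : ℕ) :
    (functor n).map S.f ≫ (functor n).map S.g = 0
  comp_δ (S : ShortComplex B) (hS : S.ShortExact) (n : ℕ) :
    (functor (n + 1)).map S.g ≫ δ S hS n = 0
  exact₁ (S : ShortComplex B) (hS : S.ShortExact) (n : ℕ) :
    (ShortComplex.mk _ _ (δ_comp S hS n)).Exact
  exact₂ (S : ShortComplex B) (hS : S.ShortExact) (n : ℕ) :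
    (ShortComplex.mk _ _ (map_comp_map S hS n)).Exact
  exact₃ (S : ShortComplex B) (hS : S.ShortExact) (n : ℕ) :
    (ShortComplex.mk _ _ (comp_δ S hS n)).Exact
  epi_zero (S : ShortComplex B) (hS : S.ShortExact) : Epi ((functor 0).map S.g)

namespace HomologicalDeltaFunctor

variable {B : Type u₁} [Category.{v₁} B] [Abelian B] {A : Type u₂} [Category.{v₂} A] [Abelian A]
  {B' : Type u₃} [Category.{v₃} B'] [Abelian B']

/-- A morphism of homological `δ`-functors: natural transformations `G_n ⟶ T_n` which commute with
the connecting morphisms. -/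
@[ext]
structure Hom (G T : HomologicalDeltaFunctor B A) where
  /-- the natural transformation in degree `n` -/
  app (n : ℕ) : G.functor n ⟶ T.functor n
  comm (S : ShortComplex B) (hS : S.ShortExact) (n : ℕ) :
    G.δ S hS n ≫ (app n).app S.X₁ = (app (n + 1)).app S.X₃ ≫ T.δ S hS n

/-- A homological `δ`-functor `T` is universal if each natural transformation `G_0 ⟶ T_0` from a
homological `δ`-functor `G` extends uniquely to a morphism of `δ`-functors `G ⟶ T`. -/
def IsUniversal (T : HomologicalDeltaFunctor B A) : Prop :=
  ∀ (G : HomologicalDeltaFunctor B A) (η : G.functor 0 ⟶ T.functor 0),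
    ∃! h : Hom G T, h.app 0 = η

/-- The composition of a homological `δ`-functor with an exact functor. -/
def precomp (T : HomologicalDeltaFunctor B A) (R : B' ⥤ B) [R.Additive] [PreservesFiniteLimits R]
    [PreservesFiniteColimits R] : HomologicalDeltaFunctor B' A where
  functor n := R ⋙ T.functor n
  additive n := by have := T.additive n; infer_instance
  δ S hS n := T.δ (S.map R) (hS.map_of_exact R) n
  δ_naturality hS hS' f n :=
    T.δ_naturality (hS.map_of_exact R) (hS'.map_of_exact R) (R.mapShortComplex.map f) n
  δ_comp S hS n := T.δ_comp (S.map R) (hS.map_of_exact R) n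
  map_comp_map S hS n := T.map_comp_map (S.map R) (hS.map_of_exact R) n
  comp_δ S hS n := T.comp_δ (S.map R) (hS.map_of_exact R) n
  exact₁ S hS n := T.exact₁ (S.map R) (hS.map_of_exact R) n
  exact₂ S hS n := T.exact₂ (S.map R) (hS.map_of_exact R) n
  exact₃ S hS n := T.exact₃ (S.map R) (hS.map_of_exact R) n
  epi_zero S hS := T.epi_zero (S.map R) (hS.map_of_exact R)

end HomologicalDeltaFunctor

/-- The left derived functors of a functor `F` between abelian categories: a universal homological
`δ`-functor `(L_n F)_{n ≥ 0}` together with an isomorphism `L_0 F ≅ F`. -/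
structure LeftDerivedFunctors {B : Type u₁} [Category.{v₁} B] [Abelian B]
    {A : Type u₂} [Category.{v₂} A] [Abelian A] (F : B ⥤ A) extends
    HomologicalDeltaFunctor B A where
  /-- the isomorphism `L_0 F ≅ F` -/
  zeroIso : functor 0 ≅ F
  universal : toHomologicalDeltaFunctor.IsUniversal

end DeltaFunctor

/-! ### Derived colimits -/

section DerivedColimit

variable {A : Type u} [Category.{v} A] [Abelian A] [HasColimits A]

/-- A choice of the derived colimit functors `colim_n^I : Fun(I, A) ⥤ A`, the left derived functors
of `colim^I`. -/
abbrev DerivedColimits (A : Type u) [Category.{v} A] [Abelian A] [HasColimits A]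
    (I : Type v) [SmallCategory.{v} I] :=
  LeftDerivedFunctors (colim : (I ⥤ A) ⥤ A)

/-- The canonical map `colim^I (E ∘ w) ⟶ colim^K E`. -/
def colimChange {I K : Type v} [SmallCategory.{v} I] [SmallCategory.{v} K] (w : I ⥤ K) :
    (Functor.whiskeringLeft I K A).obj w ⋙ colim ⟶ (colim : (K ⥤ A) ⥤ A) where
  app E := colimit.pre E w
  naturality {E E'} f := by
    refine colimit.hom_ext fun i => ?_
    simp

/-- The canonical map `colim_n^I (E ∘ w) ⟶ colim_n^K E`: the unique morphism of `δ`-functors which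
is the canonical map of colimits in degree `0`. -/
def derivedColimChange {I K : Type v} [SmallCategory.{v} I] [SmallCategory.{v} K] (w : I ⥤ K)
    (L : DerivedColimits A I) (M : DerivedColimits A K) :
    (L.precomp ((Functor.whiskeringLeft I K A).obj w)).Hom M.toHomologicalDeltaFunctor :=
  (M.universal (L.precomp ((Functor.whiskeringLeft I K A).obj w))
    (Functor.whiskerLeft _ L.zeroIso.hom ≫ colimChange w ≫ M.zeroIso.inv)).choose

/-- The map `colim_n^I D ⟶ colim_n^K E` induced by a functor `w : I ⥤ K` and a natural
transformation `τ : D ⟶ E ∘ w`. -/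
def derivedColimMap {I K : Type v} [SmallCategory.{v} I] [SmallCategory.{v} K]
    (L : DerivedColimits A I) (M : DerivedColimits A K) (w : I ⥤ K) {D : I ⥤ A} {E : K ⥤ A}
    (τ : D ⟶ w ⋙ E) (n : ℕ) : (L.functor n).obj D ⟶ (M.functor n).obj E :=
  (L.functor n).map τ ≫ ((derivedColimChange w L M).app n).app E

end DerivedColimit

end Thomason

end

open Thomason

/-!
For every small category `I`, the functors `Tor_n^I(ℤ, -)` are the derived functors of `colim^I`:
tensoring with a projective resolution of `ℤ` is exact in the diagram because coproducts are exact,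
its homology in degree zero is the colimit, and its higher homology vanishes on the left Kan
extensions of families of objects indexed by the objects of `I`, of which every diagram is a
quotient.

The Thomason complex of `T` is the tensor product of `T` with one particular projective resolution
of `ℤ` on `Δ/C`: the alternating face map complex of `[n] ↦ ℤ Hom_Δ([n], dim -)`, whose value at a
simplex `x` is the complex of chains on the contractible simplicial set `Δ[dim x]`.
-/

noncomputable section

namespace Thomason

/-! ### Maps between left derived functors -/

section LeftDerivedChange

universe v₁ v₂ v₃ u₁ u₂ u₃

variable {B : Type u₁} [Category.{v₁} B] [Abelian B] {B' : Type u₂} [Category.{v₂} B'] [Abelian B']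
  {A : Type u₃} [Category.{v₃} A] [Abelian A]

lemma nonempty_homotopy_zero {K L : ChainComplex B ℕ} (hK : ∀ n, Projective (K.X n)) {W : B}
    (q : L.X 0 ⟶ W) (hq : L.d 1 0 ≫ q = 0) (h₀ : (ShortComplex.mk _ _ hq).Exact)
    (hs : ∀ n, (ShortComplex.mk _ _ (L.d_comp_d (n + 2) (n + 1) n)).Exact) (f : K ⟶ L)
    (hf : f.f 0 ≫ q = 0) : Nonempty (Homotopy f 0) := by
  have e₁ : (f.f 1 - K.d 1 0 ≫ h₀.liftFromProjective (f.f 0) hf) ≫ L.d 1 0 = 0 := by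
    rw [Preadditive.sub_comp, Category.assoc, h₀.liftFromProjective_comp, f.comm, sub_self]
  have e₂ : ∀ (n : ℕ) (g : K.X n ⟶ L.X (n + 1)) (g' : K.X (n + 1) ⟶ L.X (n + 2))
      (_ : f.f (n + 1) = K.d (n + 1) n ≫ g + g' ≫ L.d (n + 2) (n + 1)),
      (f.f (n + 2) - K.d (n + 2) (n + 1) ≫ g') ≫ L.d (n + 2) (n + 1) = 0 := by
    intro n g g' h
    rw [Preadditive.sub_comp, Category.assoc, f.comm, h, Preadditive.comp_add,
      K.d_comp_d_assoc, zero_comp, zero_add, sub_self]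
  exact ⟨Homotopy.mkInductive _ (h₀.liftFromProjective (f.f 0) hf)
    (h₀.liftFromProjective_comp _ hf).symm
    ((hs 0).liftFromProjective _ e₁)
    (by rw [(hs 0).liftFromProjective_comp _ e₁, add_sub_cancel])
    (fun n r => ⟨(hs (n + 1)).liftFromProjective _ (e₂ n _ _ r.2.2), by
      rw [(hs (n + 1)).liftFromProjective_comp _ (e₂ n _ _ r.2.2), add_sub_cancel]⟩)⟩

lemma nonempty_homotopy_of_resolution_lifts (R : B' ⥤ B) [R.Additive] [PreservesFiniteLimits R]
    [PreservesFiniteColimits R] {Y : B} {Z : B'} {P : ProjectiveResolution Y}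
    {Q : ProjectiveResolution Z} {l l' : P.complex ⟶ (R.mapHomologicalComplex _).obj Q.complex}
    (h : l.f 0 ≫ R.map (Q.π.f 0) = l'.f 0 ≫ R.map (Q.π.f 0)) : Nonempty (Homotopy l l') := by
  obtain ⟨H⟩ := nonempty_homotopy_zero
    (L := (R.mapHomologicalComplex _).obj Q.complex) P.projective (R.map (Q.π.f 0)) _
    (Q.exact₀.map R) (fun n => (Q.exact_succ n).map R) (l - l')
    ((Preadditive.sub_comp _ _ _).trans (sub_eq_zero.2 h))
  exact ⟨Homotopy.equivSubZero.symm H⟩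

/-- If `F` is right exact, `H₀(F(P)) ≅ F(Y)` for a projective resolution `P` of `Y`. -/
def homologyZeroIso {Y : B} (P : ProjectiveResolution Y) (F : B ⥤ A) [F.Additive]
    [PreservesFiniteColimits F] :
    (HomologicalComplex.homologyFunctor A _ 0).obj
      ((F.mapHomologicalComplex _).obj P.complex) ≅ F.obj Y :=
  ChainComplex.isoHomologyι₀ _ ≪≫ asIso (P.fromLeftDerivedZero' F)

lemma homologyFunctor_map_comp_homologyZeroIso {F : B ⥤ A} [F.Additive] [PreservesFiniteColimits F]
    {F' : B' ⥤ A} [F'.Additive] [PreservesFiniteColimits F'] {Y : B} {Z : B'}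
    {P : ProjectiveResolution Y} {Q : ProjectiveResolution Z}
    {f : (F.mapHomologicalComplex _).obj P.complex ⟶ (F'.mapHomologicalComplex _).obj Q.complex}
    {g : F.obj Y ⟶ F'.obj Z} (h : f.f 0 ≫ F'.map (Q.π.f 0) = F.map (P.π.f 0) ≫ g) :
    (HomologicalComplex.homologyFunctor A _ 0).map f ≫ (homologyZeroIso Q F').hom =
      (homologyZeroIso P F).hom ≫ g := by
  have opcycles_comm : HomologicalComplex.opcyclesMap f 0 ≫ Q.fromLeftDerivedZero' F' =
      P.fromLeftDerivedZero' F ≫ g := by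
    rw [← cancel_epi (HomologicalComplex.pOpcycles _ 0), HomologicalComplex.p_opcyclesMap_assoc,
      ProjectiveResolution.pOpcycles_comp_fromLeftDerivedZero',
      ProjectiveResolution.pOpcycles_comp_fromLeftDerivedZero'_assoc]
    exact h
  change HomologicalComplex.homologyMap _ 0 ≫ HomologicalComplex.homologyι _ 0 ≫ _ =
    (HomologicalComplex.homologyι _ 0 ≫ _) ≫ _
  rw [HomologicalComplex.homologyι_naturality_assoc, asIso_hom, opcycles_comm, asIso_hom,
    Category.assoc]

variable {R : B' ⥤ B} [R.Additive] {F : B ⥤ A} [F.Additive] {F' : B' ⥤ A} [F'.Additive]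

lemma complexChange_naturality (α : R ⋙ F ⟶ F') {K L : ChainComplex B' ℕ} (f : K ⟶ L) :
    (F.mapHomologicalComplex _).map ((R.mapHomologicalComplex _).map f) ≫ complexChange α L =
      complexChange α K ≫ (F'.mapHomologicalComplex _).map f := by
  ext i
  exact α.naturality (f.f i)

variable [PreservesFiniteLimits R] [PreservesFiniteColimits R]

lemma homologyFunctor_map_complexChange_lift (α : R ⋙ F ⟶ F') {Y : B} {Z : B'} {f : Y ⟶ R.obj Z}
    {P P' : ProjectiveResolution Y} {Q Q' : ProjectiveResolution Z} {a : P'.complex ⟶ P.complex}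
    (ha : a.f 0 ≫ P.π.f 0 = P'.π.f 0 ≫ 𝟙 Y) {b : Q.complex ⟶ Q'.complex}
    (hb : b.f 0 ≫ Q'.π.f 0 = Q.π.f 0 ≫ 𝟙 Z)
    {l : P.complex ⟶ (R.mapHomologicalComplex _).obj Q.complex}
    (hl : l.f 0 ≫ R.map (Q.π.f 0) = P.π.f 0 ≫ f)
    {l' : P'.complex ⟶ (R.mapHomologicalComplex _).obj Q'.complex}
    (hl' : l'.f 0 ≫ R.map (Q'.π.f 0) = P'.π.f 0 ≫ f) (n : ℕ) :
    (HomologicalComplex.homologyFunctor A _ n).map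
        ((F.mapHomologicalComplex _).map l' ≫ complexChange α Q'.complex) =
      (HomologicalComplex.homologyFunctor A _ n).map ((F.mapHomologicalComplex _).map a) ≫
        (HomologicalComplex.homologyFunctor A _ n).map
          ((F.mapHomologicalComplex _).map l ≫ complexChange α Q.complex) ≫
        (HomologicalComplex.homologyFunctor A _ n).map ((F'.mapHomologicalComplex _).map b) := by
  have lift_eq (l₀ : P.complex.X 0 ⟶ R.obj (Q.complex.X 0))
      (hl₀ : l₀ ≫ R.map (Q.π.f 0) = P.π.f 0 ≫ f) :
      (a.f 0 ≫ l₀ ≫ R.map (b.f 0)) ≫ R.map (Q'.π.f 0) = P'.π.f 0 ≫ f := by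
    rw [Category.assoc, Category.assoc, ← R.map_comp, hb.trans (Category.comp_id _), hl₀]
    exact (Category.assoc _ _ _).symm.trans ((ha.trans (Category.comp_id _)) =≫ f)
  obtain ⟨H⟩ := nonempty_homotopy_of_resolution_lifts R
    (l' := a ≫ l ≫ (R.mapHomologicalComplex _).map b) (hl'.trans (lift_eq (l.f 0) hl).symm)
  have homotopic : (HomologicalComplex.homologyFunctor A _ n).map
      ((F.mapHomologicalComplex _).map l') = (HomologicalComplex.homologyFunctor A _ n).map
      ((F.mapHomologicalComplex _).map (a ≫ l ≫ (R.mapHomologicalComplex _).map b)) :=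
    (F.mapHomotopy H).homologyMap_eq n
  rw [Functor.map_comp, homotopic, ← Functor.map_comp, ← Functor.map_comp, ← Functor.map_comp,
    Category.assoc, ← complexChange_naturality]
  simp only [Functor.map_comp, Category.assoc]

variable [EnoughProjectives B] [EnoughProjectives B']

lemma leftDerivedChange_eq (α : R ⋙ F ⟶ F') {Y : B} {Z : B'} (f : Y ⟶ R.obj Z) (n : ℕ)
    (P : ProjectiveResolution Y) (Q : ProjectiveResolution Z)
    (l : P.complex ⟶ (R.mapHomologicalComplex _).obj Q.complex)
    (hl : l.f 0 ≫ R.map (Q.π.f 0) = P.π.f 0 ≫ f) :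
    leftDerivedChange α f n = (P.isoLeftDerivedObj F n).hom ≫
      (HomologicalComplex.homologyFunctor A _ n).map
        ((F.mapHomologicalComplex _).map l ≫ complexChange α Q.complex) ≫
      (Q.isoLeftDerivedObj F' n).inv := by
  have ha := ProjectiveResolution.lift_commutes_zero (𝟙 Y) (projectiveResolution Y) P
  have hb := ProjectiveResolution.lift_commutes_zero (𝟙 Z) Q (projectiveResolution Z)
  have hom_eq := ProjectiveResolution.isoLeftDerivedObj_hom_naturality (𝟙 Y) _ _ _ ha F n
  have inv_eq := ProjectiveResolution.isoLeftDerivedObj_inv_naturality (𝟙 Z) _ _ _ hb F' n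
  rw [CategoryTheory.Functor.map_id, Category.id_comp] at hom_eq
  rw [CategoryTheory.Functor.map_id, Category.comp_id] at inv_eq
  rw [leftDerivedChange, homologyFunctor_map_complexChange_lift α ha hb hl
    (exists_resolution_lift R _ _ f).choose_spec, hom_eq, inv_eq, Functor.comp_map,
    Functor.comp_map]
  simp only [Category.assoc]

end LeftDerivedChange

/-! ### Universal δ-functors -/

namespace HomologicalDeltaFunctor

universe v₁ v₂ v₃ u₁ u₂ u₃

variable {B : Type u₁} [Category.{v₁} B] [Abelian B] {A : Type u₂} [Category.{v₂} A] [Abelian A]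
  {B' : Type u₃} [Category.{v₃} B'] [Abelian B']

section Coeffaceable

/-- The short complex `0 ⟶ ker p ⟶ X ⟶ Y ⟶ 0` of a morphism `p : X ⟶ Y`. -/
abbrev kernelSequence {X Y : B} (p : X ⟶ Y) : ShortComplex B :=
  ShortComplex.mk (kernel.ι p) p (kernel.condition p)

lemma kernelSequence_shortExact {X Y : B} (p : X ⟶ Y) [Epi p] : (kernelSequence p).ShortExact where
  exact := ShortComplex.exact_kernel p
  mono_f := inferInstanceAs (Mono (kernel.ι p))
  epi_g := inferInstanceAs (Epi p)

/-- The morphism out of a kernel sequence with given components on the middle and right objects. -/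
def kernelSequenceMap {X Y : B} (p : X ⟶ Y) {S : ShortComplex B} (hS : S.ShortExact)
    (f : X ⟶ S.X₂) (g : Y ⟶ S.X₃) (w : f ≫ S.g = p ≫ g) : kernelSequence p ⟶ S :=
  have := hS.mono_f
  { τ₁ := hS.exact.lift (kernel.ι p ≫ f) (by
      rw [Category.assoc, w, kernel.condition_assoc, zero_comp])
    τ₂ := f
    τ₃ := g
    comm₁₂ := hS.exact.lift_f _ _
    comm₂₃ := w }

variable (G T : HomologicalDeltaFunctor B A)

lemma mono_δ {S : ShortComplex B} (hS : S.ShortExact) {n : ℕ}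
    (h : IsZero ((T.functor (n + 1)).obj S.X₂)) : Mono (T.δ S hS n) :=
  (T.exact₃ S hS n).mono_g (h.eq_of_src _ _)

section Lift

variable {n : ℕ} (α : G.functor n ⟶ T.functor n) {S : ShortComplex B} (hS : S.ShortExact)
  (h : IsZero ((T.functor (n + 1)).obj S.X₂))

/-- If `T_{n+1}(X₂) = 0`, then `T_{n+1}(X₃)` is the kernel of `T_n(X₁) ⟶ T_n(X₂)`, and a natural
transformation `G_n ⟶ T_n` induces `G_{n+1}(X₃) ⟶ T_{n+1}(X₃)`. -/
def liftSucc : (G.functor (n + 1)).obj S.X₃ ⟶ (T.functor (n + 1)).obj S.X₃ :=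
  have := T.mono_δ hS h
  (T.exact₁ S hS n).lift (G.δ S hS n ≫ α.app S.X₁) (by
    rw [Category.assoc, ← α.naturality, ← Category.assoc, G.δ_comp, zero_comp])

lemma liftSucc_δ : liftSucc G T α hS h ≫ T.δ S hS n = G.δ S hS n ≫ α.app S.X₁ :=
  have := T.mono_δ hS h
  (T.exact₁ S hS n).lift_f _ _

lemma liftSucc_map_δ {S' : ShortComplex B} (hS' : S'.ShortExact) (f : S ⟶ S') :
    liftSucc G T α hS h ≫ (T.functor (n + 1)).map f.τ₃ ≫ T.δ S' hS' n =
      (G.functor (n + 1)).map f.τ₃ ≫ G.δ S' hS' n ≫ α.app S'.X₁ := by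
  rw [← T.δ_naturality hS hS', ← Category.assoc, liftSucc_δ, Category.assoc, ← α.naturality,
    ← Category.assoc, G.δ_naturality hS hS', Category.assoc]

lemma liftSucc_naturality {S' : ShortComplex B} (hS' : S'.ShortExact)
    (h' : IsZero ((T.functor (n + 1)).obj S'.X₂)) (f : S ⟶ S') :
    (G.functor (n + 1)).map f.τ₃ ≫ liftSucc G T α hS' h' =
      liftSucc G T α hS h ≫ (T.functor (n + 1)).map f.τ₃ := by
  have := T.mono_δ hS' h'
  rw [← cancel_mono (T.δ S' hS' n), Category.assoc, liftSucc_δ, Category.assoc, liftSucc_map_δ]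

end Lift

section Extend

variable {E : B ⥤ B} (ε : E ⟶ 𝟭 B) [∀ X, Epi (ε.app X)]
  (hE : ∀ (n : ℕ) (X : B), IsZero ((T.functor (n + 1)).obj (E.obj X)))

/-- The extension of a natural transformation `G_n ⟶ T_n` to degree `n + 1`, if the functor
`T_{n+1}` vanishes on the objects `E(X)`. -/
def extendSucc (n : ℕ) (α : G.functor n ⟶ T.functor n) :
    G.functor (n + 1) ⟶ T.functor (n + 1) where
  app X := liftSucc G T α (kernelSequence_shortExact (ε.app X)) (hE n X)
  naturality {X Y} f := liftSucc_naturality G T α (kernelSequence_shortExact (ε.app X)) (hE n X)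
    (kernelSequence_shortExact (ε.app Y)) (hE n Y)
    (kernelSequenceMap (ε.app X) (kernelSequence_shortExact (ε.app Y)) (E.map f) f
      (ε.naturality f))

lemma extendSucc_comm (n : ℕ) (α : G.functor n ⟶ T.functor n) (S : ShortComplex B)
    (hS : S.ShortExact) :
    G.δ S hS n ≫ α.app S.X₁ = (extendSucc G T ε hE n α).app S.X₃ ≫ T.δ S hS n := by
  have := hS.epi_g
  have hK := kernelSequence_shortExact (ε.app S.X₃)
  have hQ := kernelSequence_shortExact (ε.app S.X₂ ≫ S.g)
  have toS := liftSucc_map_δ G T α hQ (hE n S.X₂) hS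
    (kernelSequenceMap _ hS (ε.app S.X₂) (𝟙 _) (Category.comp_id _).symm)
  have toKernel := liftSucc_naturality G T α hQ (hE n S.X₂) hK (hE n S.X₃)
    (kernelSequenceMap _ hK (E.map S.g) (𝟙 _)
      ((ε.naturality S.g).trans (Category.comp_id _).symm))
  dsimp only [kernelSequenceMap] at toS toKernel
  erw [CategoryTheory.Functor.map_id, CategoryTheory.Functor.map_id, Category.id_comp,
    Category.id_comp] at toS
  erw [CategoryTheory.Functor.map_id, CategoryTheory.Functor.map_id, Category.id_comp,
    Category.comp_id] at toKernel
  rw [← toS, ← toKernel]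
  rfl

lemma eq_extendSucc (n : ℕ) (α : G.functor n ⟶ T.functor n)
    (β : G.functor (n + 1) ⟶ T.functor (n + 1))
    (hβ : ∀ (S : ShortComplex B) (hS : S.ShortExact),
      G.δ S hS n ≫ α.app S.X₁ = β.app S.X₃ ≫ T.δ S hS n) : β = extendSucc G T ε hE n α := by
  ext X
  have hX := kernelSequence_shortExact (ε.app X)
  have := T.mono_δ hX (hE n X)
  rw [← cancel_mono (T.δ _ hX n)]
  exact (hβ _ hX).symm.trans (extendSucc_comm G T ε hE n α _ _)

end Extend

theorem isUniversal_of_coeffaceable {E : B ⥤ B} (ε : E ⟶ 𝟭 B) [∀ X, Epi (ε.app X)]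
    (hE : ∀ (n : ℕ) (X : B), IsZero ((T.functor (n + 1)).obj (E.obj X))) : T.IsUniversal := by
  intro G η
  let a (n : ℕ) : G.functor n ⟶ T.functor n := Nat.rec η (extendSucc G T ε hE) n
  refine ⟨⟨a, fun S hS n => extendSucc_comm G T ε hE n (a n) S hS⟩, rfl, fun g hg => ?_⟩
  have app_eq (n : ℕ) : g.app n = a n := by
    induction n with
    | zero => exact hg
    | succ n ih =>
      exact eq_extendSucc G T ε hE n (a n) _ fun S hS => by rw [← ih, g.comm]
  exact Hom.ext (funext app_eq)

end Coeffaceable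

section OfComplexes

/-- The homological `δ`-functor given by the homology of an exact functor to chain complexes. -/
def ofComplexes (K : B ⥤ ChainComplex A ℕ) [K.Additive]
    (hK : ∀ S : ShortComplex B, S.ShortExact → (S.map K).ShortExact) :
    HomologicalDeltaFunctor B A where
  functor n := K ⋙ HomologicalComplex.homologyFunctor A _ n
  additive _ := inferInstance
  δ S hS n := (hK S hS).δ (n + 1) n rfl
  δ_naturality hS hS' f n :=
    HomologicalComplex.HomologySequence.δ_naturality (K.mapShortComplex.map f) (hK _ hS) (hK _ hS')
      (n + 1) n rfl
  δ_comp S hS n := (hK S hS).δ_comp (n + 1) n rfl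
  map_comp_map S _ n := by
    rw [← Functor.map_comp, S.zero]
    exact Functor.map_zero _ _ _
  comp_δ S hS n := (hK S hS).comp_δ (n + 1) n rfl
  exact₁ S hS n := (hK S hS).homology_exact₁ (n + 1) n rfl
  exact₂ S hS n := (hK S hS).homology_exact₂ n
  exact₃ S hS n := (hK S hS).homology_exact₃ (n + 1) n rfl
  epi_zero S hS :=
    have : Epi (K.map S.g) := (hK S hS).epi_g
    HomologicalComplex.epi_homologyMap_of_epi_of_not_rel (K.map S.g) 0 (by simp)

/-- The morphism of `δ`-functors induced by a natural transformation between exact functors to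
chain complexes. -/
def homOfComplexes {K : B ⥤ ChainComplex A ℕ} [K.Additive]
    (hK : ∀ S : ShortComplex B, S.ShortExact → (S.map K).ShortExact)
    {K' : B' ⥤ ChainComplex A ℕ} [K'.Additive]
    (hK' : ∀ S : ShortComplex B', S.ShortExact → (S.map K').ShortExact)
    (R : B' ⥤ B) [R.Additive] [PreservesFiniteLimits R] [PreservesFiniteColimits R]
    (α : R ⋙ K ⟶ K') : ((ofComplexes K hK).precomp R).Hom (ofComplexes K' hK') where
  app n := Functor.whiskerRight α (HomologicalComplex.homologyFunctor A _ n)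
  comm S hS n :=
    HomologicalComplex.HomologySequence.δ_naturality
      (S₁ := (S.map R).map K) (S₂ := S.map K')
      { τ₁ := α.app S.X₁, τ₂ := α.app S.X₂, τ₃ := α.app S.X₃,
        comm₁₂ := (α.naturality S.f).symm, comm₂₃ := (α.naturality S.g).symm }
      (hK _ (hS.map_of_exact R)) (hK' _ hS) (n + 1) n rfl

end OfComplexes

section Hom

variable {S T U : HomologicalDeltaFunctor B A}

/-- The identity morphism of a homological `δ`-functor. -/
def Hom.refl (T : HomologicalDeltaFunctor B A) : Hom T T where
  app _ := 𝟙 _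
  comm _ _ _ := (Category.comp_id _).trans (Category.id_comp _).symm

/-- The composition of morphisms of homological `δ`-functors. -/
def Hom.comp (g : Hom S T) (h : Hom T U) : Hom S U where
  app n := g.app n ≫ h.app n
  comm X hX n := by
    rw [NatTrans.comp_app, NatTrans.comp_app, Category.assoc, ← h.comm, ← Category.assoc,
      g.comm, Category.assoc]

/-- The composition of a morphism of homological `δ`-functors with an exact functor. -/
def Hom.precomp (g : Hom S T) (R : B' ⥤ B) [R.Additive] [PreservesFiniteLimits R]
    [PreservesFiniteColimits R] : Hom (S.precomp R) (T.precomp R) where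
  app n := Functor.whiskerLeft R (g.app n)
  comm X hX n := g.comm (X.map R) (hX.map_of_exact R) n

lemma IsUniversal.hom_ext (hT : T.IsUniversal) {g h : Hom S T} (e : g.app 0 = h.app 0) : g = h :=
  (hT S (h.app 0)).unique e rfl

end Hom

end HomologicalDeltaFunctor

namespace LeftDerivedFunctors

open HomologicalDeltaFunctor

universe v₁ v₂ u₁ u₂

variable {B : Type u₁} [Category.{v₁} B] [Abelian B] {A : Type u₂} [Category.{v₂} A] [Abelian A]
  {F : B ⥤ A}

/-- The comparison morphism between two choices of left derived functors. -/
def compare (L M : LeftDerivedFunctors F) :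
    L.toHomologicalDeltaFunctor.Hom M.toHomologicalDeltaFunctor :=
  (M.universal L.toHomologicalDeltaFunctor (L.zeroIso.hom ≫ M.zeroIso.inv)).choose

lemma compare_app_zero (L M : LeftDerivedFunctors F) :
    (compare L M).app 0 = L.zeroIso.hom ≫ M.zeroIso.inv :=
  (M.universal L.toHomologicalDeltaFunctor (L.zeroIso.hom ≫ M.zeroIso.inv)).choose_spec.1

lemma compare_comp_compare (L M : LeftDerivedFunctors F) :
    (compare L M).comp (compare M L) = Hom.refl _ := by
  refine L.universal.hom_ext ?_
  change (compare L M).app 0 ≫ (compare M L).app 0 = 𝟙 _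
  rw [compare_app_zero, compare_app_zero, Category.assoc, Iso.inv_hom_id_assoc, Iso.hom_inv_id]

/-- The comparison isomorphisms between two choices of left derived functors. -/
def compareIso (L M : LeftDerivedFunctors F) (n : ℕ) : L.functor n ≅ M.functor n where
  hom := (compare L M).app n
  inv := (compare M L).app n
  hom_inv_id := congrArg (fun h : Hom _ _ => h.app n) (compare_comp_compare L M)
  inv_hom_id := congrArg (fun h : Hom _ _ => h.app n) (compare_comp_compare M L)

end LeftDerivedFunctors

section DerivedColimits

open HomologicalDeltaFunctor LeftDerivedFunctors

variable {A : Type u} [Category.{v} A] [Abelian A] [HasColimits A]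
  {I K : Type v} [SmallCategory.{v} I] [SmallCategory.{v} K]

lemma derivedColimChange_app_zero (w : I ⥤ K) (L : DerivedColimits A I) (M : DerivedColimits A K) :
    (derivedColimChange w L M).app 0 =
      Functor.whiskerLeft _ L.zeroIso.hom ≫ colimChange w ≫ M.zeroIso.inv :=
  (M.universal (L.precomp ((Functor.whiskeringLeft I K A).obj w))
    (Functor.whiskerLeft _ L.zeroIso.hom ≫ colimChange w ≫ M.zeroIso.inv)).choose_spec.1

lemma derivedColimChange_compare (w : I ⥤ K) (L L' : DerivedColimits A I)
    (M M' : DerivedColimits A K) :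
    (derivedColimChange w L M).comp (compare M M') =
      ((compare L L').precomp ((Functor.whiskeringLeft I K A).obj w)).comp
        (derivedColimChange w L' M') := by
  refine M'.universal.hom_ext ?_
  change (derivedColimChange w L M).app 0 ≫ (compare M M').app 0 =
    Functor.whiskerLeft _ ((compare L L').app 0) ≫ (derivedColimChange w L' M').app 0
  rw [derivedColimChange_app_zero, derivedColimChange_app_zero, compare_app_zero,
    compare_app_zero]
  ext E
  simp [precomp]

lemma derivedColimMap_compare (L L' : DerivedColimits A I) (M M' : DerivedColimits A K)
    (w : I ⥤ K) {D : I ⥤ A} {E : K ⥤ A} (τ : D ⟶ w ⋙ E) (n : ℕ) :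
    derivedColimMap L M w τ n ≫ (compareIso M M' n).hom.app E =
      (compareIso L L' n).hom.app D ≫ derivedColimMap L' M' w τ n := by
  have h : ((derivedColimChange w L M).app n).app E ≫ ((compare M M').app n).app E =
      ((compare L L').app n).app (w ⋙ E) ≫ ((derivedColimChange w L' M').app n).app E :=
    congrArg (fun g : Hom _ _ => (g.app n).app E) (derivedColimChange_compare w L L' M M')
  refine (Category.assoc _ _ _).trans ((_ ≫= h).trans ?_)
  exact ((compare L L').app n).naturality_assoc τ _

end DerivedColimits

/-! ### Free diagrams of abelian groups -/

section Basis

variable {J : Type v} [SmallCategory.{v} J] {Q : Type v} {i : Q → J} {F : J ⥤ AddCommGrpCat.{v}}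
  {b : ∀ q, F.obj (i q)}

/-- The elements `b q ∈ F(i q)` form a basis of the diagram `F` of abelian groups if each family of
elements `y q ∈ G(i q)` is the image of `b` under a unique morphism `F ⟶ G`; equivalently, `F` is
the direct sum of the functors `ℤ Hom_J(i q, -)` via `b`. -/
def IsBasis (F : J ⥤ AddCommGrpCat.{v}) (i : Q → J) (b : ∀ q, F.obj (i q)) : Prop :=
  ∀ (G : J ⥤ AddCommGrpCat.{v}) (y : ∀ q, G.obj (i q)), ∃! f : F ⟶ G, ∀ q, f.app (i q) (b q) = y q

lemma isBasis_sigma_freeRep (i : Q → J) :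
    IsBasis (∐ fun q => freeRep (i q)) i
      fun q => freeRepEquiv _ _ (Sigma.ι (fun q => freeRep (i q)) q) := by
  intro G y
  refine ⟨Sigma.desc fun q => (freeRepEquiv _ G).symm (y q), fun q => ?_, fun f hf => ?_⟩
  · rw [← freeRepEquiv_comp, Sigma.ι_desc, Equiv.apply_symm_apply]
  · refine Sigma.hom_ext _ _ fun q => (freeRepEquiv _ G).injective ?_
    rw [freeRepEquiv_comp, hf, Sigma.ι_desc, Equiv.apply_symm_apply]

namespace IsBasis

lemma hom_ext (hb : IsBasis F i b) {G : J ⥤ AddCommGrpCat.{v}} {f g : F ⟶ G}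
    (h : ∀ q, f.app (i q) (b q) = g.app (i q) (b q)) : f = g :=
  (hb G _).unique h fun _ => rfl

lemma projective (hb : IsBasis F i b) : Projective F where
  factors {G G'} f e he := by
    have surj (q : Q) : ∃ y, e.app (i q) y = f.app (i q) (b q) :=
      (AddCommGrpCat.epi_iff_surjective (e.app (i q))).1 inferInstance _
    choose y hy using surj
    obtain ⟨l, hl, -⟩ := hb G y
    exact ⟨l, hb.hom_ext fun q => by rw [NatTrans.comp_app, ConcreteCategory.comp_apply, hl, hy]⟩

end IsBasis

lemma exists_retract_sigma_freeRep (F : J ⥤ AddCommGrpCat.{v}) [Projective F] :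
    ∃ (Q : Type v) (i : Q → J), Nonempty (Retract F (∐ fun q => freeRep (i q))) := by
  let i (q : Σ j, F.obj j) : J := q.1
  obtain ⟨p, hp, -⟩ := isBasis_sigma_freeRep i F Sigma.snd
  have : Epi p := ⟨fun g h w => by
    ext j y
    refine Eq.trans ?_ ((ConcreteCategory.congr_hom (NatTrans.congr_app w j)
      (freeRepEquiv j _ (Sigma.ι (fun q => freeRep (i q)) ⟨j, y⟩))).trans ?_)
    · exact congrArg (g.app j) (hp ⟨j, y⟩).symm
    · exact congrArg (h.app j) (hp ⟨j, y⟩)⟩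
  exact ⟨_, i, ⟨Projective.factorThru (𝟙 F) p, p, Projective.factorThru_comp _ _⟩⟩

end Basis

/-! ### Exactness of the symbolic tensor product -/

section Retract

variable {A : Type u} [Category.{v} A] [Abelian A]

lemma shortExact_of_retract {S T : ShortComplex A} (r : Retract S T) (hT : T.ShortExact) :
    S.ShortExact where
  exact := by
    rw [ShortComplex.exact_iff_isZero_homology]
    let r' : Retract S.homology T.homology := r.map (ShortComplex.homologyFunctor A)
    exact ((ShortComplex.exact_iff_isZero_homology T).1 hT.exact).of_mono r'.i
  mono_f := by
    have := hT.mono_f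
    have : Mono r.i.τ₁ := (r.map ShortComplex.π₁).splitMono.mono
    exact mono_of_mono_fac r.i.comm₁₂.symm
  epi_g := by
    have := hT.epi_g
    have : Epi r.r.τ₃ := (r.map ShortComplex.π₃).splitEpi.epi
    exact epi_of_epi_fac r.r.comm₂₃

end Retract

section TensorExact

variable {A : Type u} [Category.{v} A] [Abelian A] [HasColimits A]
variable {I : Type v} [SmallCategory.{v} I]

variable (A I) in
/-- The symbolic tensor product as a functor `D ↦ (F ↦ F ⊗_I D)` of both variables. -/
@[simps]
def tensorBifunctor : (I ⥤ A) ⥤ (Iᵒᵖ ⥤ AddCommGrpCat.{v}) ⥤ A where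
  obj D := symbolicTensor D
  map τ := symbolicTensorHom τ
  map_id := symbolicTensorHom_id
  map_comp := symbolicTensorHom_comp

instance (F : Iᵒᵖ ⥤ AddCommGrpCat.{v}) : ((tensorBifunctor A I).flip.obj F).Additive where
  map_add {D E τ τ'} := tensorObj_hom_ext fun i x => by
    change tensorι D F i x ≫ tensorMapRight (τ + τ') F =
      tensorι D F i x ≫ (tensorMapRight τ F + tensorMapRight τ' F)
    rw [Preadditive.comp_add, tensorι_mapRight, tensorι_mapRight, tensorι_mapRight,
      NatTrans.app_add, Preadditive.add_comp]

variable {Q : Type v} {i : Q → I} {F : Iᵒᵖ ⥤ AddCommGrpCat.{v}} {b : ∀ q, F.obj (op (i q))}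

/-- If `F` has a basis `b`, then `F ⊗_I D` is the coproduct of the objects `D(i q)`. -/
def IsBasis.isColimitTensor (hb : IsBasis F (fun q => op (i q)) b) (D : I ⥤ A) :
    IsColimit (Cofan.mk (tensorObj D F) fun q => tensorι D F (i q) (b q)) :=
  Cofan.IsColimit.mk _
    (fun s => (tensorHomEquiv D F s.pt).symm (hb ((homFunctor D).obj s.pt) s.inj).choose)
    (fun s q => (tensorι_homEquiv_symm _ (i q) (b q)).trans
      ((hb ((homFunctor D).obj s.pt) s.inj).choose_spec.1 q))
    (fun s m hm => by
      rw [Equiv.eq_symm_apply]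
      exact (hb ((homFunctor D).obj s.pt) s.inj).choose_spec.2 _ hm)

/-- If `F` has a basis `b`, the isomorphism `∐ D(i q) ≅ F ⊗_I D` which is `a ↦ b q ⊗ a` on the
summand of `q`. -/
def IsBasis.colimitIsoTensor (hb : IsBasis F (fun q => op (i q)) b) (D : I ⥤ A) :
    colimit (Discrete.functor i ⋙ D) ≅ tensorObj D F :=
  (colimit.isColimit _).coconePointsIsoOfNatIso (hb.isColimitTensor D)
    (Discrete.compNatIsoDiscrete i D)

lemma IsBasis.ι_colimitIsoTensor_hom (hb : IsBasis F (fun q => op (i q)) b) (D : I ⥤ A) (q : Q) :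
    colimit.ι (Discrete.functor i ⋙ D) ⟨q⟩ ≫ (hb.colimitIsoTensor D).hom =
      tensorι D F (i q) (b q) :=
  ((colimit.isColimit _).ι_map _ _ _).trans (Category.id_comp _)

/-- The isomorphism `∐ D(i q) ≅ F ⊗_I D`, as an isomorphism of functors of `D`. -/
def IsBasis.coprodIsoTensor (hb : IsBasis F (fun q => op (i q)) b) :
    (Functor.whiskeringLeft _ _ A).obj (Discrete.functor i) ⋙ colim ≅
      (tensorBifunctor A I).flip.obj F :=
  NatIso.ofComponents hb.colimitIsoTensor fun {D E} τ => colimit.hom_ext fun ⟨q⟩ => by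
    change colimit.ι _ _ ≫ colimMap (Functor.whiskerLeft _ τ) ≫ _ =
      colimit.ι _ _ ≫ _ ≫ tensorMapRight τ F
    rw [ι_colimMap_assoc, hb.ι_colimitIsoTensor_hom, ← Category.assoc, hb.ι_colimitIsoTensor_hom,
      tensorι_mapRight]
    rfl

variable [AB4 A]

lemma IsBasis.shortExact_tensor (hb : IsBasis F (fun q => op (i q)) b) {S : ShortComplex (I ⥤ A)}
    (hS : S.ShortExact) : (S.map ((tensorBifunctor A I).flip.obj F)).ShortExact := by
  have := preservesFiniteLimits_of_natIso (hb.coprodIsoTensor (A := A))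
  have := preservesFiniteColimits_of_natIso (hb.coprodIsoTensor (A := A))
  exact hS.map_of_exact _

/-- A projective diagram of abelian groups is a retract of one which has a basis. -/
lemma shortExact_tensor_of_projective (P : Iᵒᵖ ⥤ AddCommGrpCat.{v}) [Projective P]
    {S : ShortComplex (I ⥤ A)} (hS : S.ShortExact) :
    (S.map ((tensorBifunctor A I).flip.obj P)).ShortExact := by
  obtain ⟨Q, i, ⟨r⟩⟩ := exists_retract_sigma_freeRep P
  let r' := r.map (tensorBifunctor A I).flip
  refine shortExact_of_retract ⟨S.mapNatTrans r'.i, S.mapNatTrans r'.r, ?_⟩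
    ((isBasis_sigma_freeRep i).shortExact_tensor (i := fun q => (i q).unop) hS)
  ext : 1 <;> exact NatTrans.congr_app r'.retract _

end TensorExact

/-! ### Tensor products with left Kan extensions -/

section TensorKan

variable {A : Type u} [Category.{v} A]
variable {I K : Type v} [SmallCategory.{v} I] [SmallCategory.{v} K]
variable {w : I ⥤ K} {D : I ⥤ A} {E : K ⥤ A} {τ : D ⟶ w ⋙ E}

lemma pointwise_hom_ext (h : (Functor.LeftExtension.mk E τ).IsPointwiseLeftKanExtension) {k : K}
    {X : A} {f f' : E.obj k ⟶ X}
    (hf : ∀ (i : I) (g : w.obj i ⟶ k), τ.app i ≫ E.map g ≫ f = τ.app i ≫ E.map g ≫ f') : f = f' :=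
  (h k).hom_ext fun g =>
    (Category.assoc _ _ _).trans ((hf g.left g.hom).trans (Category.assoc _ _ _).symm)

variable [Abelian A] [HasColimits A]

/-- If `E` is the pointwise left Kan extension of `D` along `w`, the morphism
`E(k) ⟶ (F ∘ w) ⊗_I D` sending `E(g)(τ(a))`, for `g : w i ⟶ k`, to `F(g)(x) ⊗ a`. -/
def tensorOfPointwise (h : (Functor.LeftExtension.mk E τ).IsPointwiseLeftKanExtension)
    (F : Kᵒᵖ ⥤ AddCommGrpCat.{v}) {k : K} (x : F.obj (op k)) :
    E.obj k ⟶ tensorObj D (w.op ⋙ F) :=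
  (h k).desc
    { pt := tensorObj D (w.op ⋙ F)
      ι.app g := tensorι D (w.op ⋙ F) g.left (F.map g.hom.op x)
      ι.naturality g g' t := by
        have ht : F.map g.hom.op x = (w.op ⋙ F).map t.left.op (F.map g'.hom.op x) := by
          rw [← CostructuredArrow.w t, op_comp, F.map_comp]
          rfl
        exact ((Category.comp_id _).trans
          ((congrArg _ ht).trans (tensorι_map D (w.op ⋙ F) t.left _))).symm }

variable (h : (Functor.LeftExtension.mk E τ).IsPointwiseLeftKanExtension)
  (F : Kᵒᵖ ⥤ AddCommGrpCat.{v})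

lemma map_tensorOfPointwise {i : I} {k : K} (g : w.obj i ⟶ k) (x : F.obj (op k)) :
    τ.app i ≫ E.map g ≫ tensorOfPointwise h F x = tensorι D (w.op ⋙ F) i (F.map g.op x) :=
  (Category.assoc _ _ _).symm.trans ((h k).fac _ (CostructuredArrow.mk g))

lemma tensorOfPointwise_map {k k' : K} (t : k ⟶ k') (x : F.obj (op k')) :
    tensorOfPointwise h F (F.map t.op x) = E.map t ≫ tensorOfPointwise h F x :=
  pointwise_hom_ext h fun i g => by
    rw [map_tensorOfPointwise, ← E.map_comp_assoc, map_tensorOfPointwise, op_comp, F.map_comp,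
      ConcreteCategory.comp_apply]

lemma tensorOfPointwise_add {k : K} (x y : F.obj (op k)) :
    tensorOfPointwise h F (x + y) = tensorOfPointwise h F x + tensorOfPointwise h F y :=
  pointwise_hom_ext h fun i g => by
    rw [Preadditive.comp_add, Preadditive.comp_add, map_tensorOfPointwise, map_tensorOfPointwise,
      map_tensorOfPointwise, map_add]
    exact tensorι_add D (w.op ⋙ F) i _ _

lemma tensorOfPointwise_change {k : K} (x : F.obj (op k)) :
    tensorOfPointwise h F x ≫ tensorChange w τ F = tensorι E F k x :=
  pointwise_hom_ext h fun i g => by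
    rw [reassoc_of% map_tensorOfPointwise h F g x, tensorι_change, tensorι_map]

/-- The projection formula `(F ∘ w) ⊗_I D ≅ F ⊗_K Lan_w D`. -/
lemma isIso_tensorChange (h : (Functor.LeftExtension.mk E τ).IsPointwiseLeftKanExtension)
    (F : Kᵒᵖ ⥤ AddCommGrpCat.{v}) : IsIso (tensorChange w τ F) := by
  refine ⟨tensorDesc E F (fun k x => tensorOfPointwise h F x)
    (fun _ _ => tensorOfPointwise_map h F) (fun _ => tensorOfPointwise_add h F),
    tensorObj_hom_ext fun i x => ?_, tensorObj_hom_ext fun k x => ?_⟩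
  · have key := map_tensorOfPointwise h F (𝟙 (w.obj i)) x
    erw [E.map_id, Category.id_comp, F.map_id] at key
    rw [tensorι_change_assoc, tensorι_desc, key, Category.comp_id]
    rfl
  · rw [← Category.assoc, tensorι_desc, tensorOfPointwise_change, Category.comp_id]

end TensorKan

/-! ### Diagrams on discrete categories -/

section Discrete

lemma projective_of_discrete {X : Type v} (F : (Discrete X)ᵒᵖ ⥤ AddCommGrpCat.{v})
    (hF : ∀ x, Projective (F.obj x)) : Projective F where
  factors {G G'} f e he :=
    ⟨{ app x := Projective.factorThru (f.app x) (e.app x)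
       naturality := by
        rintro ⟨⟨x⟩⟩ ⟨⟨y⟩⟩ ⟨⟨⟨⟨⟩⟩⟩⟩
        exact (F.map_id _ =≫ _).trans ((Category.id_comp _).trans
          ((Category.comp_id _).symm.trans (_ ≫= (G.map_id _).symm))) },
      NatTrans.ext (funext fun x => Projective.factorThru_comp _ _)⟩

lemma projective_obj {J : Type v} [SmallCategory.{v} J] (P : J ⥤ AddCommGrpCat.{v}) [Projective P]
    (j : J) : Projective (P.obj j) := by
  have : (evaluationRightAdjoint AddCommGrpCat.{v} j).PreservesEpimorphisms :=
    { preserves {G G'} f _ := by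
        have epi_app (k : J) :
            Epi (((evaluationRightAdjoint AddCommGrpCat.{v} j).map f).app k) := by
          let t : Discrete.functor (fun _ : k ⟶ j => G) ⟶ Discrete.functor fun _ => G' :=
            Discrete.natTrans fun _ => f
          have epi_app (q) : Epi (t.app q) := ‹Epi f›
          have : Epi t := NatTrans.epi_of_epi_app t
          exact inferInstanceAs (Epi (lim.map t))
        exact NatTrans.epi_of_epi_app _ }
  exact (evaluationAdjunctionLeft AddCommGrpCat.{v} j).map_projective P ‹_›

end Discrete

/-! ### Tensor products with `ℤ` -/

section ConstZ

variable {A : Type u} [Category.{v} A] [Abelian A] [HasColimits A]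
variable {I : Type v} [SmallCategory.{v} I]

/-- The morphism `ℤ ⟶ G` with `1 ↦ s i` at `i`. -/
def constZDesc (G : Iᵒᵖ ⥤ AddCommGrpCat.{v}) (s : ∀ i, G.obj i)
    (hs : ∀ {i j : Iᵒᵖ} (t : i ⟶ j), G.map t (s i) = s j) : constZ I ⟶ G where
  app i := AddCommGrpCat.ofHom ((zmultiplesHom _ (s i)).comp AddEquiv.ulift.toAddMonoidHom)
  naturality i j t := by
    ext ⟨n⟩
    change n • s j = G.map t (n • s i)
    rw [map_zsmul, hs]

lemma constZDesc_one (G : Iᵒᵖ ⥤ AddCommGrpCat.{v}) (s : ∀ i, G.obj i)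
    (hs : ∀ {i j : Iᵒᵖ} (t : i ⟶ j), G.map t (s i) = s j) (i : Iᵒᵖ) :
    (constZDesc G s hs).app i ⟨1⟩ = s i :=
  one_zsmul _

lemma constZ_hom_ext {G : Iᵒᵖ ⥤ AddCommGrpCat.{v}} {f g : constZ I ⟶ G}
    (h : ∀ i, f.app i ⟨1⟩ = g.app i ⟨1⟩) : f = g := by
  ext i ⟨n⟩
  have hn : (⟨n⟩ : (constZ I).obj i) = n • ⟨1⟩ := ULift.ext _ _ (mul_one n).symm
  rw [hn]
  exact (map_zsmul (f.app i).hom n _).trans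
    ((congrArg (n • ·) (h i)).trans (map_zsmul (g.app i).hom n _).symm)

instance {X : Type v} : Projective (constZ (Discrete X)) where
  factors {G G'} f e he := by
    have surj (x) : ∃ y, e.app x y = f.app x ⟨1⟩ :=
      (AddCommGrpCat.epi_iff_surjective (e.app x)).1 inferInstance _
    choose y hy using surj
    have hG {x x' : (Discrete X)ᵒᵖ} (t : x ⟶ x') : G.map t (y x) = y x' := by
      obtain ⟨⟨x⟩⟩ := x
      obtain ⟨⟨x'⟩⟩ := x'
      obtain ⟨⟨⟨⟨⟩⟩⟩⟩ := t
      exact ConcreteCategory.congr_hom (G.map_id _) _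
    exact ⟨constZDesc G y hG, constZ_hom_ext fun x =>
      (congrArg _ (constZDesc_one G y hG x)).trans (hy x)⟩

/-- The coprojections `D(i) ⟶ ℤ ⊗_I D`, `a ↦ 1 ⊗ a`. -/
@[simps]
def tensorConstZCocone (D : I ⥤ A) : Cocone D where
  pt := tensorObj D (constZ I)
  ι.app i := tensorι D (constZ I) i ⟨1⟩
  ι.naturality _ _ t := (tensorι_map D (constZ I) t ⟨1⟩).symm.trans (Category.comp_id _).symm

/-- `ℤ ⊗_I D` is the colimit of `D`. -/
def isColimitTensorConstZCocone (D : I ⥤ A) : IsColimit (tensorConstZCocone D) where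
  desc s := (tensorHomEquiv D (constZ I) s.pt).symm
    (constZDesc ((homFunctor D).obj s.pt) (fun i => s.ι.app i.unop) fun t => s.w t.unop)
  fac s i := (tensorι_homEquiv_symm _ i _).trans (constZDesc_one ((homFunctor D).obj s.pt) _ _ _)
  uniq s _ hm := (Equiv.eq_symm_apply (tensorHomEquiv D (constZ I) s.pt)).2
    (constZ_hom_ext fun i => (hm i.unop).trans
      (constZDesc_one ((homFunctor D).obj s.pt) (fun i => s.ι.app i.unop) _ i).symm)

end ConstZ

/-! ### Tensor products with complexes -/

section TensorComplex

variable (A : Type u) [Category.{v} A] [Abelian A] [HasColimits A]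
variable {I K : Type v} [SmallCategory.{v} I] [SmallCategory.{v} K]

/-- The tensor product `P ⊗_I D` with a complex `P` of diagrams of abelian groups, as a functor
of `D`. -/
@[simps]
def tensorComplex (P : ChainComplex (Iᵒᵖ ⥤ AddCommGrpCat.{v}) ℕ) : (I ⥤ A) ⥤ ChainComplex A ℕ where
  obj D := ((symbolicTensor D).mapHomologicalComplex _).obj P
  map τ := (NatTrans.mapHomologicalComplex (symbolicTensorHom τ) _).app P
  map_id D := by
    ext n
    exact NatTrans.congr_app (symbolicTensorHom_id D) (P.X n)
  map_comp τ τ' := by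
    ext n
    exact NatTrans.congr_app (symbolicTensorHom_comp τ τ') (P.X n)

instance (P : ChainComplex (Iᵒᵖ ⥤ AddCommGrpCat.{v}) ℕ) : (tensorComplex A P).Additive where
  map_add {_ _ _ _} := by
    ext n
    exact ((tensorBifunctor A I).flip.obj (P.X n)).map_add

lemma tensorComplex_shortExact [AB4 A] {P : ChainComplex (Iᵒᵖ ⥤ AddCommGrpCat.{v}) ℕ}
    (hP : ∀ n, Projective (P.X n)) (S : ShortComplex (I ⥤ A)) (hS : S.ShortExact) :
    (S.map (tensorComplex A P)).ShortExact :=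
  HomologicalComplex.shortExact_of_degreewise_shortExact _ fun n =>
    have := hP n
    shortExact_tensor_of_projective (P.X n) hS

lemma tensorMapRight_comp_change {w : I ⥤ K} {D D' : I ⥤ A} {E : K ⥤ A} (σ : D ⟶ D')
    (τ : D' ⟶ w ⋙ E) (F : Kᵒᵖ ⥤ AddCommGrpCat.{v}) :
    tensorMapRight σ (w.op ⋙ F) ≫ tensorChange w τ F = tensorChange w (σ ≫ τ) F :=
  tensorObj_hom_ext fun i x => by
    rw [tensorι_mapRight_assoc, tensorι_change, tensorι_change, NatTrans.comp_app, Category.assoc]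

lemma tensorChange_comp_mapRight {w : I ⥤ K} {D : I ⥤ A} {E E' : K ⥤ A} (τ : D ⟶ w ⋙ E)
    (σ : E ⟶ E') (F : Kᵒᵖ ⥤ AddCommGrpCat.{v}) :
    tensorChange w τ F ≫ tensorMapRight σ F = tensorChange w (τ ≫ Functor.whiskerLeft w σ) F :=
  tensorObj_hom_ext fun i x => by
    rw [tensorι_change_assoc, tensorι_mapRight, tensorι_change, NatTrans.comp_app, Category.assoc,
      Functor.whiskerLeft_app]

variable {A} (w : I ⥤ K) {P : ChainComplex (Iᵒᵖ ⥤ AddCommGrpCat.{v}) ℕ}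
  {Q : ChainComplex (Kᵒᵖ ⥤ AddCommGrpCat.{v}) ℕ}
  (l : P ⟶ ((restrictAb w).mapHomologicalComplex _).obj Q)

/-- The morphism `P ⊗_I D ⟶ Q ⊗_K E` induced by morphisms `P ⟶ Q ∘ w` and `D ⟶ E ∘ w`. -/
def tensorComplexMap {D : I ⥤ A} {E : K ⥤ A} (τ : D ⟶ w ⋙ E) :
    (tensorComplex A P).obj D ⟶ (tensorComplex A Q).obj E :=
  ((symbolicTensor D).mapHomologicalComplex _).map l ≫ complexChange (symbolicTensorChange w τ) Q

lemma tensorComplex_map_comp_tensorComplexMap {D D' : I ⥤ A} {E : K ⥤ A} (σ : D ⟶ D')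
    (τ : D' ⟶ w ⋙ E) :
    (tensorComplex A P).map σ ≫ tensorComplexMap w l τ = tensorComplexMap w l (σ ≫ τ) := by
  ext n
  change tensorMapRight σ (P.X n) ≫ tensorMapLeft D' (l.f n) ≫ tensorChange w τ (Q.X n) =
    tensorMapLeft D (l.f n) ≫ tensorChange w (σ ≫ τ) (Q.X n)
  rw [← tensorMapRight_comp_change]
  exact ((symbolicTensorHom σ).naturality_assoc (l.f n) _).symm

lemma tensorComplexMap_comp_tensorComplex_map {D : I ⥤ A} {E E' : K ⥤ A} (τ : D ⟶ w ⋙ E)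
    (σ : E ⟶ E') :
    tensorComplexMap w l τ ≫ (tensorComplex A Q).map σ =
      tensorComplexMap w l (τ ≫ Functor.whiskerLeft w σ) := by
  ext n
  exact (Category.assoc _ _ _).trans (_ ≫= tensorChange_comp_mapRight A τ σ (Q.X n))

/-- The morphism `P ⊗_I (E ∘ w) ⟶ Q ⊗_K E` induced by a morphism `P ⟶ Q ∘ w`, as a natural
transformation of functors of `E`. -/
def tensorComplexChange :
    (Functor.whiskeringLeft I K A).obj w ⋙ tensorComplex A P ⟶ tensorComplex A Q where
  app E := tensorComplexMap w l (𝟙 (w ⋙ E))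
  naturality _ _ σ := (tensorComplex_map_comp_tensorComplexMap w l _ _).trans
    ((congrArg _ ((Category.comp_id _).trans (Category.id_comp _).symm)).trans
      (tensorComplexMap_comp_tensorComplex_map w l _ σ).symm)

end TensorComplex

section Resolution

variable (A : Type u) [Category.{v} A] [Abelian A] [HasColimits A]
variable {I K : Type v} [SmallCategory.{v} I] [SmallCategory.{v} K]
  (P : ProjectiveResolution (constZ I)) (Q : ProjectiveResolution (constZ K))

/-- Computation of `Tor_n^I(ℤ, -)` by a projective resolution of `ℤ`. -/
def torZIso (n : ℕ) :
    torZ A I n ≅ tensorComplex A P.complex ⋙ HomologicalComplex.homologyFunctor A _ n :=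
  NatIso.ofComponents (fun D => P.isoLeftDerivedObj (symbolicTensor D) n) fun τ =>
    (Iso.eq_comp_inv _).1 ((P.leftDerived_app_eq (symbolicTensorHom τ) n).trans
      (Category.assoc _ _ _).symm)

variable {A}

lemma torZMap_torZIso (w : I ⥤ K) {D : I ⥤ A} {E : K ⥤ A} (τ : D ⟶ w ⋙ E) (n : ℕ)
    {l : P.complex ⟶ ((restrictAb w).mapHomologicalComplex _).obj Q.complex}
    (hl : l.f 0 ≫ (restrictAb w).map (Q.π.f 0) = P.π.f 0) :
    torZMap w τ n ≫ (torZIso A Q n).hom.app E = (torZIso A P n).hom.app D ≫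
      (HomologicalComplex.homologyFunctor A _ n).map (tensorComplexMap w l τ) :=
  (Iso.eq_comp_inv _).1 ((leftDerivedChange_eq (symbolicTensorChange w τ)
    (Y := constZ I) (Z := constZ K) _ n P Q l (hl.trans (Category.comp_id _).symm)).trans
      (Category.assoc _ _ _).symm)

end Resolution

section DegreeZero

variable {A : Type u} [Category.{v} A] [Abelian A] [HasColimits A]
variable {I K : Type v} [SmallCategory.{v} I] [SmallCategory.{v} K]

/-- The isomorphism `ℤ ⊗_I D ≅ colim^I D`. -/
def tensorConstZIso (D : I ⥤ A) : tensorObj D (constZ I) ≅ colimit D :=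
  (isColimitTensorConstZCocone D).coconePointUniqueUpToIso (colimit.isColimit D)

lemma tensorι_tensorConstZIso_hom (D : I ⥤ A) (i : I) :
    tensorι D (constZ I) i ⟨1⟩ ≫ (tensorConstZIso D).hom = colimit.ι D i :=
  (isColimitTensorConstZCocone D).comp_coconePointUniqueUpToIso_hom _ i

lemma tensorMapRight_tensorConstZIso {D E : I ⥤ A} (τ : D ⟶ E) :
    tensorMapRight τ (constZ I) ≫ (tensorConstZIso E).hom =
      (tensorConstZIso D).hom ≫ colim.map τ :=
  (isColimitTensorConstZCocone D).hom_ext fun i => by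
    have h := tensorι_mapRight_assoc τ (constZ I) i ⟨1⟩ (tensorConstZIso E).hom
    rw [tensorι_tensorConstZIso_hom] at h
    have h' := tensorι_tensorConstZIso_hom D i =≫ colim.map τ
    refine h.trans (Eq.trans ?_ (h'.symm.trans (Category.assoc _ _ _)))
    simp

lemma tensorChange_tensorConstZIso (w : I ⥤ K) {D : I ⥤ A} {E : K ⥤ A} (τ : D ⟶ w ⋙ E) :
    tensorChange w τ (constZ K) ≫ (tensorConstZIso E).hom =
      (tensorConstZIso D).hom ≫ colim.map τ ≫ colimit.pre E w :=
  (isColimitTensorConstZCocone D).hom_ext fun i => by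
    have h := tensorι_change_assoc w τ (constZ K) i ⟨1⟩ (tensorConstZIso E).hom
    rw [tensorι_tensorConstZIso_hom] at h
    have h' := tensorι_tensorConstZIso_hom D i =≫ (colim.map τ ≫ colimit.pre E w)
    refine h.trans (Eq.trans ?_ (h'.symm.trans (Category.assoc _ _ _)))
    simp

instance (D : I ⥤ A) : PreservesFiniteColimits (symbolicTensor D) :=
  have : PreservesColimits (symbolicTensor D) := (symbolicTensorAdj D).leftAdjoint_preservesColimits
  inferInstance

variable (P : ProjectiveResolution (constZ I)) (Q : ProjectiveResolution (constZ K))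

/-- The isomorphism `H₀(P ⊗_I D) ≅ colim^I D`. -/
def tensorHomologyZeroIso (D : I ⥤ A) :
    (HomologicalComplex.homologyFunctor A _ 0).obj ((tensorComplex A P.complex).obj D) ≅
      colimit D :=
  homologyZeroIso P (symbolicTensor D) ≪≫ tensorConstZIso D

variable {P Q}

lemma homologyFunctor_map_comp_tensorHomologyZeroIso {D : I ⥤ A} {E : K ⥤ A}
    {f : (tensorComplex A P.complex).obj D ⟶ (tensorComplex A Q.complex).obj E}
    {g : tensorObj D (constZ I) ⟶ tensorObj E (constZ K)} {c : colimit D ⟶ colimit E}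
    (hf : f.f 0 ≫ tensorMapLeft E (Q.π.f 0) = tensorMapLeft D (P.π.f 0) ≫ g)
    (hg : g ≫ (tensorConstZIso E).hom = (tensorConstZIso D).hom ≫ c) :
    (HomologicalComplex.homologyFunctor A _ 0).map f ≫ (tensorHomologyZeroIso Q E).hom =
      (tensorHomologyZeroIso P D).hom ≫ c := by
  refine (Category.assoc _ _ _).symm.trans
    ((homologyFunctor_map_comp_homologyZeroIso hf =≫ _).trans ((Category.assoc _ _ _).trans ?_))
  exact (_ ≫= hg).trans (Category.assoc _ _ _).symm

lemma tensorComplexMap_comp_tensorHomologyZeroIso {w : I ⥤ K} {D : I ⥤ A} {E : K ⥤ A}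
    (τ : D ⟶ w ⋙ E) {l : P.complex ⟶ ((restrictAb w).mapHomologicalComplex _).obj Q.complex}
    (hl : l.f 0 ≫ (restrictAb w).map (Q.π.f 0) = P.π.f 0) :
    (HomologicalComplex.homologyFunctor A _ 0).map (tensorComplexMap w l τ) ≫
        (tensorHomologyZeroIso Q E).hom =
      (tensorHomologyZeroIso P D).hom ≫ colim.map τ ≫ colimit.pre E w := by
  refine homologyFunctor_map_comp_tensorHomologyZeroIso ?_ (tensorChange_tensorConstZIso w τ)
  refine (Category.assoc _ _ _).trans
    ((_ ≫= ((symbolicTensorChange w τ).naturality (Q.π.f 0)).symm).trans ?_)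
  refine ((symbolicTensor D).map_comp_assoc _ _ _).symm.trans ?_
  exact congrArg (fun g => (symbolicTensor D).map g ≫ _) hl

end DegreeZero

section Vanishing

variable (A : Type u) [Category.{v} A] [Abelian A] [HasColimits A] (I : Type v)
  [SmallCategory.{v} I]

/-- The inclusion of the objects of `I`. -/
abbrev inclObj : Discrete I ⥤ I := Discrete.functor id

/-- The functor sending `D` to the left Kan extension of its restriction to the objects of `I`. -/
def discreteCover : (I ⥤ A) ⥤ (I ⥤ A) :=
  (Functor.whiskeringLeft _ _ A).obj (inclObj I) ⋙ (inclObj I).lan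

/-- The canonical epimorphism of `discreteCover A I` onto the identity functor. -/
def discreteCoverHom : discreteCover A I ⟶ 𝟭 _ := ((inclObj I).lanAdjunction A).counit

instance : ((Functor.whiskeringLeft _ _ A).obj (inclObj I)).Faithful where
  map_injective {D E} f g h := by
    ext i
    exact NatTrans.congr_app h ⟨i⟩

instance (D : I ⥤ A) : Epi ((discreteCoverHom A I).app D) :=
  inferInstanceAs (Epi (((inclObj I).lanAdjunction A).counit.app D))

instance : (restrictAb (inclObj I)).PreservesProjectiveObjects where
  projective_obj {P} _ := projective_of_discrete _ fun _ => projective_obj P _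

variable {I}

lemma isZero_homology_tensor_discreteCover (P : ProjectiveResolution (constZ I)) (D : I ⥤ A)
    (n : ℕ) : IsZero ((HomologicalComplex.homologyFunctor A _ (n + 1)).obj
      ((tensorComplex A P.complex).obj ((discreteCover A I).obj D))) := by
  let τ := (inclObj I).lanUnit.app (inclObj I ⋙ D)
  let P' := (restrictAb (inclObj I)).mapProjectiveResolution P
  have : Projective ((restrictAb (inclObj I)).obj (constZ I)) :=
    inferInstanceAs (Projective (constZ (Discrete I)))
  have isIso_app (F) : IsIso ((symbolicTensorChange (inclObj I) τ).app F) :=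
    isIso_tensorChange (Functor.isPointwiseLeftKanExtensionLeftKanExtensionUnit _ _) F
  have isIso_f (m) : IsIso ((complexChange (symbolicTensorChange (inclObj I) τ) P.complex).f m) :=
    isIso_app _
  have : IsIso (complexChange (symbolicTensorChange (inclObj I) τ) P.complex) :=
    HomologicalComplex.Hom.isIso_of_components _
  have zero := ((symbolicTensor (inclObj I ⋙ D)).isZero_leftDerived_obj_projective_succ n
    ((restrictAb (inclObj I)).obj (constZ I))).of_iso
      (P'.isoLeftDerivedObj (symbolicTensor (inclObj I ⋙ D)) (n + 1)).symm
  exact zero.of_iso ((HomologicalComplex.homologyFunctor A _ (n + 1)).mapIso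
    (asIso (complexChange (symbolicTensorChange (inclObj I) τ) P.complex)).symm)

end Vanishing

/-! ### Tor and the derived functors of the colimit -/

section Comparison

open HomologicalDeltaFunctor LeftDerivedFunctors

variable {A : Type u} [Category.{v} A] [Abelian A] [HasColimits A] [AB4 A]
variable {I K : Type v} [SmallCategory.{v} I] [SmallCategory.{v} K]

/-- The derived functors of `colim^I`, computed by a projective resolution of `ℤ`. -/
def torDerivedColimits (P : ProjectiveResolution (constZ I)) : DerivedColimits A I where
  __ := ofComplexes (tensorComplex A P.complex)
    (tensorComplex_shortExact A P.projective)
  zeroIso := NatIso.ofComponents (tensorHomologyZeroIso P) fun τ =>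
    homologyFunctor_map_comp_tensorHomologyZeroIso
      ((symbolicTensorHom τ).naturality (P.π.f 0)).symm (tensorMapRight_tensorConstZIso τ)
  universal := isUniversal_of_coeffaceable _ (discreteCoverHom A I)
    fun n D => isZero_homology_tensor_discreteCover A P D n

variable {P : ProjectiveResolution (constZ I)} {Q : ProjectiveResolution (constZ K)}

lemma derivedColimChange_torDerivedColimits (w : I ⥤ K)
    {l : P.complex ⟶ ((restrictAb w).mapHomologicalComplex _).obj Q.complex}
    (hl : l.f 0 ≫ (restrictAb w).map (Q.π.f 0) = P.π.f 0) :
    derivedColimChange w (torDerivedColimits (A := A) P) (torDerivedColimits Q) =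
      homOfComplexes (tensorComplex_shortExact A P.projective)
        (tensorComplex_shortExact A Q.projective) _ (tensorComplexChange w l) := by
  refine (torDerivedColimits (A := A) Q).universal.hom_ext ?_
  ext E
  have map_id : colim.map (𝟙 (w ⋙ E)) ≫ colimit.pre E w = colimit.pre E w :=
    (congrArg (· ≫ _) (colim.map_id _)).trans (Category.id_comp _)
  have map_zero := (tensorComplexMap_comp_tensorHomologyZeroIso (𝟙 (w ⋙ E)) hl).trans (_ ≫= map_id)
  refine (NatTrans.congr_app (derivedColimChange_app_zero w _ _) E).trans ?_
  exact (Category.assoc _ _ _).symm.trans ((Iso.comp_inv_eq _).2 map_zero.symm)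

lemma derivedColimMap_torDerivedColimits {w : I ⥤ K} {D : I ⥤ A} {E : K ⥤ A} (τ : D ⟶ w ⋙ E)
    (n : ℕ) {l : P.complex ⟶ ((restrictAb w).mapHomologicalComplex _).obj Q.complex}
    (hl : l.f 0 ≫ (restrictAb w).map (Q.π.f 0) = P.π.f 0) :
    derivedColimMap (torDerivedColimits P) (torDerivedColimits Q) w τ n =
      (HomologicalComplex.homologyFunctor A _ n).map (tensorComplexMap w l τ) := by
  rw [derivedColimMap, derivedColimChange_torDerivedColimits w hl]
  refine ((HomologicalComplex.homologyFunctor A _ n).map_comp _ _).symm.trans ?_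
  refine (HomologicalComplex.homologyFunctor A _ n).congr_map
    ((tensorComplex_map_comp_tensorComplexMap w l _ _).trans ?_)
  rw [Category.comp_id]

/-- The comparison of `Tor_n^I(ℤ, -)` with the `n`-th derived functor of `colim^I`. -/
def torZIsoDerivedColim (L : DerivedColimits A I) (n : ℕ) : torZ A I n ≅ L.functor n :=
  torZIso A (projectiveResolution (constZ I)) n ≪≫ compareIso (torDerivedColimits _) L n

lemma torZMap_torZIsoDerivedColim (L : DerivedColimits A I) (M : DerivedColimits A K) (w : I ⥤ K)
    {D : I ⥤ A} {E : K ⥤ A} (τ : D ⟶ w ⋙ E) (n : ℕ) :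
    torZMap w τ n ≫ (torZIsoDerivedColim M n).hom.app E =
      (torZIsoDerivedColim L n).hom.app D ≫ derivedColimMap L M w τ n := by
  obtain ⟨l, hl⟩ := exists_resolution_lift (restrictAb w) (projectiveResolution (constZ I))
    (projectiveResolution (constZ K)) { app _ := 𝟙 _ }
  have hl' := hl.trans (Category.comp_id _)
  have tor := torZMap_torZIso _ _ w τ n hl'
  rw [← derivedColimMap_torDerivedColimits τ n hl'] at tor
  have compare := derivedColimMap_compare (torDerivedColimits (projectiveResolution (constZ I))) L
    (torDerivedColimits (projectiveResolution (constZ K))) M w τ n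
  refine (Category.assoc _ _ _).symm.trans ((tor =≫ _).trans ((Category.assoc _ _ _).trans ?_))
  exact (_ ≫= compare).trans (Category.assoc _ _ _).symm

end Comparison

/-! ### The simplex resolution of `ℤ` -/

section SimplexRep

variable (C : Type v) [SmallCategory.{v} C]

/-- The functor `dim : Δ/C ⥤ Δ`. -/
@[simps]
def SimplexOver.forgetDim : SimplexOver C ⥤ SimplexCategory where
  obj x := x.dim
  map f := f.toHom

/-- The simplicial object `[n] ↦ ℤ Hom_Δ([n], dim -)` in `Fun(Δ/C, Ab)`. -/
def simplexRep : SimplicialObject ((SimplexOver C)ᵒᵖᵒᵖ ⥤ AddCommGrpCat.{v}) :=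
  Functor.flip (unopUnop _ ⋙ SimplexOver.forgetDim C ⋙ SSet.stdSimplex.{v} ⋙
    (SimplicialObject.whiskering _ _).obj AddCommGrpCat.free)

variable {C}

/-- The generator `σ` of `ℤ Hom_Δ([n], dim x)`. -/
def simplexGen (x : SimplexOver C) {n : SimplexCategory} (σ : n ⟶ x.dim) :
    ((simplexRep C).obj (op n)).obj (op (op x)) :=
  FreeAbelianGroup.of (SSet.stdSimplex.objEquiv.symm σ)

lemma simplexRep_map_app_gen (x : SimplexOver C) {m n : SimplexCategory} (a : m ⟶ n)
    (σ : n ⟶ x.dim) :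
    ((simplexRep C).map a.op).app (op (op x)) (simplexGen x σ) = simplexGen x (a ≫ σ) :=
  FreeAbelianGroup.map_of_apply _

lemma simplexRep_obj_map_gen {x y : SimplexOver C} (u : x ⟶ y) {n : SimplexCategory}
    (σ : n ⟶ x.dim) :
    ((simplexRep C).obj (op n)).map u.op.op (simplexGen x σ) = simplexGen y (σ ≫ u.toHom) :=
  FreeAbelianGroup.map_of_apply _

lemma simplexGen_ofHom {m n : SimplexCategory} (a : m ⟶ n) (f : (nerve C).obj (op n)) :
    ((simplexRep C).obj (op m)).map (SimplexOver.ofHom a f).op.op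
        (simplexGen ⟨m, (nerve C).map a.op f⟩ (𝟙 m)) = simplexGen ⟨n, f⟩ a :=
  (simplexRep_obj_map_gen _ _).trans (congrArg (simplexGen _) (Category.id_comp a))

lemma simplexRep_obj_obj_hom_ext {x : SimplexOver C} {n : SimplexCategory} {M : AddCommGrpCat.{v}}
    {p q : ((simplexRep C).obj (op n)).obj (op (op x)) ⟶ M}
    (h : ∀ σ : n ⟶ x.dim, p (simplexGen x σ) = q (simplexGen x σ)) : p = q :=
  AddCommGrpCat.hom_ext (FreeAbelianGroup.lift_ext _ _ fun σ => h (SSet.stdSimplex.objEquiv σ))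

/-- The morphism `ℤ Hom_Δ([n], dim -) ⟶ F` given by elements of `F(f)` for all `f : [n] ⥤ C`. -/
def simplexRepDesc {n : SimplexCategory} {F : (SimplexOver C)ᵒᵖᵒᵖ ⥤ AddCommGrpCat.{v}}
    (y : ∀ f : (nerve C).obj (op n), F.obj (op (op ⟨n, f⟩))) : (simplexRep C).obj (op n) ⟶ F where
  app x := AddCommGrpCat.ofHom (FreeAbelianGroup.lift fun σ =>
    F.map (SimplexOver.ofHom (SSet.stdSimplex.objEquiv σ) x.unop.unop.diagram).op.op (y _))
  naturality := by
    rintro ⟨⟨⟨m, g⟩⟩⟩ ⟨⟨⟨k, f⟩⟩⟩ ⟨⟨⟨a, w⟩⟩⟩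
    change m ⟶ k at a
    change (nerve C).map a.op f = g at w
    subst w
    refine simplexRep_obj_obj_hom_ext fun σ => ?_
    refine (ConcreteCategory.comp_apply _ _ _).trans
      (Eq.trans ?_ (ConcreteCategory.comp_apply _ _ _).symm)
    refine (DFunLike.congr_arg _ (simplexRep_obj_map_gen (SimplexOver.ofHom a f) σ)).trans ?_
    refine (FreeAbelianGroup.lift_apply_of _ _).trans ?_
    refine Eq.trans ?_ (DFunLike.congr_arg _ (FreeAbelianGroup.lift_apply_of _ _)).symm
    exact F.map_comp_apply (SimplexOver.ofHom σ ((nerve C).map a.op f)).op.op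
      (SimplexOver.ofHom a f).op.op _

lemma simplexRepDesc_gen {n : SimplexCategory} {F : (SimplexOver C)ᵒᵖᵒᵖ ⥤ AddCommGrpCat.{v}}
    (y : ∀ f : (nerve C).obj (op n), F.obj (op (op ⟨n, f⟩))) (x : SimplexOver C) (σ : n ⟶ x.dim) :
    (simplexRepDesc y).app (op (op x)) (simplexGen x σ) =
      F.map (SimplexOver.ofHom σ x.diagram).op.op (y _) :=
  FreeAbelianGroup.lift_apply_of _ _

lemma isBasis_simplexRep (n : SimplexCategoryᵒᵖ) :
    IsBasis ((simplexRep C).obj n) (fun f : (nerve C).obj n => op (op ⟨n.unop, f⟩))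
      fun f => simplexGen ⟨n.unop, f⟩ (𝟙 n.unop) := by
  intro F y
  refine ⟨simplexRepDesc y, fun f => ?_, fun p hp => ?_⟩
  · exact (simplexRepDesc_gen y _ _).trans (ConcreteCategory.congr_hom (F.map_id _) (y f))
  · ext1
    ext1 ⟨⟨x⟩⟩
    refine simplexRep_obj_obj_hom_ext fun σ => (Eq.trans ?_ (simplexRepDesc_gen y x σ).symm)
    rw [← hp, ← NatTrans.naturality_apply]
    exact congrArg _ (simplexGen_ofHom σ x.diagram).symm

/-- The isomorphism between the free abelian group on one element and `ℤ`. -/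
def freeTerminalIso : AddCommGrpCat.free.obj (⊤_ Type v) ≅ AddCommGrpCat.of (ULift.{v} ℤ) :=
  AddCommGrpCat.free.mapIso Types.terminalIso ≪≫
    ((FreeAbelianGroup.uniqueEquiv PUnit.{v + 1}).trans AddEquiv.ulift.symm).toAddCommGrpIso

lemma free_map_comp_map_terminal_from {X Y : Type v} (f : X ⟶ Y) :
    AddCommGrpCat.free.map f ≫ AddCommGrpCat.free.map (terminal.from Y) ≫ freeTerminalIso.hom =
      AddCommGrpCat.free.map (terminal.from X) ≫ freeTerminalIso.hom := by
  rw [← Functor.map_comp_assoc, terminal.comp_from]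

variable (C) in
/-- The simplicial object `[n] ↦ ℤ Hom_Δ([n], dim -)` with its augmentation to `ℤ`, which maps all
generators to `1`. -/
def simplexRepAugmented :
    SimplicialObject.Augmented ((SimplexOver C)ᵒᵖᵒᵖ ⥤ AddCommGrpCat.{v}) where
  left := simplexRep C
  right := constZ (SimplexOver C)ᵒᵖ
  hom :=
    { app n :=
        { app _ := AddCommGrpCat.free.map (terminal.from _) ≫ freeTerminalIso.hom
          naturality _ _ _ := (free_map_comp_map_terminal_from _).trans (Category.comp_id _).symm }
      naturality _ _ _ := by
        ext1
        ext1 x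
        exact (free_map_comp_map_terminal_from _).trans (Category.comp_id _).symm }

/-- The value of the augmented simplicial object `ℤ Hom_Δ(-, dim -)` at `x` is the free abelian
group on the augmented standard simplex of dimension `dim x`. -/
def simplexRepAugmentedEvaluation (x : SimplexOver C) :
    ((SimplicialObject.Augmented.whiskering _ _).obj AddCommGrpCat.free).obj
        (SSet.Augmented.stdSimplex.{v}.obj x.dim) ≅
      ((SimplicialObject.Augmented.whiskering _ AddCommGrpCat.{v}).obj
        ((evaluation (SimplexOver C)ᵒᵖᵒᵖ _).obj (op (op x)))).obj (simplexRepAugmented C) :=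
  Comma.isoMk (Iso.refl _) freeTerminalIso (by
    refine NatTrans.ext (funext fun n => ?_)
    exact (Category.id_comp _).symm)

/-- The values of the augmented simplicial object `ℤ Hom_Δ(-, dim -)` have extra degeneracies. -/
def simplexRepExtraDegeneracy (x : SimplexOver C) :
    (((SimplicialObject.Augmented.whiskering _ _).obj ((evaluation _ _).obj (op (op x)))).obj
      (simplexRepAugmented C)).ExtraDegeneracy :=
  ((SSet.Augmented.StandardSimplex.extraDegeneracy x.dim).map AddCommGrpCat.free).ofIso
    (simplexRepAugmentedEvaluation x)

end SimplexRep

section SimplexResolution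

open AlgebraicTopology

open scoped Simplicial

section

universe v₁ v₂ u₁ u₂

variable {B : Type u₁} [Category.{v₁} B] [Preadditive B] {B' : Type u₂} [Category.{v₂} B']
  [Preadditive B'] (F : B ⥤ B') [F.Additive]

/-- An additive functor commutes with the alternating face map complex. -/
def mapAlternatingFaceMapComplexIso (X : SimplicialObject B) :
    (F.mapHomologicalComplex _).obj ((alternatingFaceMapComplex B).obj X) ≅
      (alternatingFaceMapComplex B').obj (((SimplicialObject.whiskering _ _).obj F).obj X) :=
  (eqToIso (map_alternatingFaceMapComplex F)).app X

lemma mapAlternatingFaceMapComplexIso_hom_f (X : SimplicialObject B) (n : ℕ) :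
    (mapAlternatingFaceMapComplexIso F X).hom.f n = 𝟙 (F.obj (X _⦋n⦌)) := by
  rw [mapAlternatingFaceMapComplexIso, Iso.app_hom, eqToIso.hom, eqToHom_app,
    HomologicalComplex.eqToHom_f]
  rfl

lemma mapAlternatingFaceMapComplexIso_inv_f (X : SimplicialObject B) (n : ℕ) :
    (mapAlternatingFaceMapComplexIso F X).inv.f n = 𝟙 (F.obj (X _⦋n⦌)) := by
  rw [mapAlternatingFaceMapComplexIso, Iso.app_inv, eqToIso.inv, eqToHom_app,
    HomologicalComplex.eqToHom_f]
  rfl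

variable [HasZeroObject B] [HasZeroObject B']

lemma map_ε_comp_single (X : SimplicialObject.Augmented B) :
    (F.mapHomologicalComplex _).map (AlternatingFaceMapComplex.ε.app X) ≫
        (HomologicalComplex.singleMapHomologicalComplex F _ 0).hom.app X.right =
      (mapAlternatingFaceMapComplexIso F X.left).hom ≫ AlternatingFaceMapComplex.ε.app
        (((SimplicialObject.Augmented.whiskering _ _).obj F).obj X) := by
  apply HomologicalComplex.to_single_hom_ext
  refine Eq.trans ?_ (congrArg₂ (· ≫ ·) (mapAlternatingFaceMapComplexIso_hom_f F X.left 0)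
    (AlternatingFaceMapComplex.ε_app_f_zero _)).symm
  refine (congrArg₂ (· ≫ ·) (congrArg F.map (AlternatingFaceMapComplex.ε_app_f_zero X))
    (HomologicalComplex.singleMapHomologicalComplex_hom_app_self F _ 0 X.right)).trans ?_
  exact (congrArg (F.map (X.hom.app (op ⦋0⦌)) ≫ ·) ((F.map_id X.right =≫ _).trans
    (Category.id_comp _))).trans (Category.id_comp _).symm

variable [CategoryWithHomology B']

lemma quasiIso_map_ε (X : SimplicialObject.Augmented B)
    (ed : (((SimplicialObject.Augmented.whiskering _ _).obj F).obj X).ExtraDegeneracy) :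
    QuasiIso ((F.mapHomologicalComplex _).map (AlternatingFaceMapComplex.ε.app X)) :=
  (quasiIso_iff_of_arrow_mk_iso _ _ (Arrow.isoMk (mapAlternatingFaceMapComplexIso F X.left)
    ((HomologicalComplex.singleMapHomologicalComplex F _ 0).app X.right)
    (map_ε_comp_single F X).symm)).2 (HomotopyEquiv.quasiIso_hom ed.homotopyEquiv)

end

variable (C : Type v) [SmallCategory.{v} C]

/-- The projective resolution of `ℤ` by the functors `ℤ Hom_Δ([n], dim -)`. -/
def simplexResolution : ProjectiveResolution (constZ (SimplexOver C)ᵒᵖ) where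
  complex := (alternatingFaceMapComplex _).obj (simplexRep C)
  projective n := (isBasis_simplexRep (op ⦋n⦌)).projective
  π := AlternatingFaceMapComplex.ε.app (simplexRepAugmented C)
  quasiIso := (HomologicalComplex.quasiIso_iff_evaluation
    (AlternatingFaceMapComplex.ε.app (simplexRepAugmented C))).2 fun ⟨⟨x⟩⟩ =>
      quasiIso_map_ε _ _ (simplexRepExtraDegeneracy x)

lemma simplexResolution_π_f_zero :
    (simplexResolution C).π.f 0 = (simplexRepAugmented C).hom.app (op ⦋0⦌) :=
  AlternatingFaceMapComplex.ε_app_f_zero _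

end SimplexResolution

/-! ### Thomason homology -/

section ThomasonTensor

open AlgebraicTopology

open scoped Simplicial

variable {A : Type u} [Category.{v} A] [Abelian A] [HasColimits A]
  {C : Type v} [SmallCategory.{v} C]

/-- The isomorphism between the coproduct of the `T(f)` over all `f : [n] ⥤ C` and
`ℤ Hom_Δ([n], dim -) ⊗ T`. -/
def coprodSimplicesIsoTensor (T : (SimplexOver C)ᵒᵖ ⥤ A) (n : SimplexCategoryᵒᵖ) :
    coprodSimplices T n ≅ tensorObj T ((simplexRep C).obj n) :=
  (coproductIsCoproduct fun f : (nerve C).obj n =>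
    T.obj (op ⟨n.unop, f⟩)).coconePointUniqueUpToIso ((isBasis_simplexRep n).isColimitTensor T)

lemma coprodSimplicesι_isoTensor (T : (SimplexOver C)ᵒᵖ ⥤ A) (n : SimplexCategoryᵒᵖ)
    (f : (nerve C).obj n) :
    coprodSimplicesι T n f ≫ (coprodSimplicesIsoTensor T n).hom =
      tensorι T ((simplexRep C).obj n) (op ⟨n.unop, f⟩) (simplexGen ⟨n.unop, f⟩ (𝟙 n.unop)) :=
  IsColimit.comp_coconePointUniqueUpToIso_hom (coproductIsCoproduct _) _ (Discrete.mk f)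

lemma coprodSimplicesDesc_comp_isoTensor {C' : Type v} [SmallCategory.{v} C']
    {T : (SimplexOver C)ᵒᵖ ⥤ A} {T' : (SimplexOver C')ᵒᵖ ⥤ A} {n m : SimplexCategoryᵒᵖ}
    (r : (nerve C).obj n → (nerve C').obj m)
    (p : ∀ f, T.obj (op ⟨n.unop, f⟩) ⟶ T'.obj (op ⟨m.unop, r f⟩))
    (q : tensorObj T ((simplexRep C).obj n) ⟶ tensorObj T' ((simplexRep C').obj m))
    (h : ∀ f, tensorι T ((simplexRep C).obj n) (op ⟨n.unop, f⟩) (simplexGen _ (𝟙 n.unop)) ≫ q =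
      p f ≫ tensorι T' ((simplexRep C').obj m) (op ⟨m.unop, r f⟩) (simplexGen _ (𝟙 m.unop))) :
    coprodSimplicesDesc T n (fun f => p f ≫ coprodSimplicesι T' m (r f)) ≫
        (coprodSimplicesIsoTensor T' m).hom =
      (coprodSimplicesIsoTensor T n).hom ≫ q :=
  coprodSimplices_hom_ext fun f => by
    rw [coprodSimplicesι_desc_assoc, Category.assoc, coprodSimplicesι_isoTensor, ← Category.assoc,
      coprodSimplicesι_isoTensor, h]

/-- The isomorphism between the simplicial replacement of `T` and `ℤ Hom_Δ(-, dim -) ⊗ T`. -/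
def simplicialReplacementIsoTensor (T : (SimplexOver C)ᵒᵖ ⥤ A) :
    simplicialReplacementObj T ≅
      ((SimplicialObject.whiskering _ _).obj (symbolicTensor T)).obj (simplexRep C) :=
  NatIso.ofComponents (coprodSimplicesIsoTensor T) fun {n m} a =>
    coprodSimplicesDesc_comp_isoTensor _ _ _ fun f => by
      refine (tensorι_mapLeft T ((simplexRep C).map a) _ _).trans ?_
      refine Eq.trans (congrArg (tensorι T _ _) ?_)
        (tensorι_map T ((simplexRep C).obj m) (SimplexOver.ofHom a.unop f).op _)
      refine (simplexRep_map_app_gen ⟨n.unop, f⟩ a.unop (𝟙 n.unop)).trans ?_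
      exact (congrArg _ (Category.comp_id a.unop)).trans (simplexGen_ofHom a.unop f).symm

/-- The isomorphism between the Thomason complex of `T` and the simplex resolution of `ℤ` tensored
with `T`. -/
def thomasonComplexObjIsoTensor (T : (SimplexOver C)ᵒᵖ ⥤ A) :
    (thomasonComplex A C).obj T ≅ (tensorComplex A (simplexResolution C).complex).obj T :=
  (alternatingFaceMapComplex A).mapIso (simplicialReplacementIsoTensor T) ≪≫
    (mapAlternatingFaceMapComplexIso (symbolicTensor T) (simplexRep C)).symm

lemma thomasonComplexObjIsoTensor_hom_f (T : (SimplexOver C)ᵒᵖ ⥤ A) (n : ℕ) :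
    (thomasonComplexObjIsoTensor T).hom.f n = (coprodSimplicesIsoTensor T (op ⦋n⦌)).hom :=
  (_ ≫= mapAlternatingFaceMapComplexIso_inv_f _ _ n).trans (Category.comp_id _)

variable (A C) in
/-- The isomorphism between the Thomason complex and the simplex resolution of `ℤ` tensored with
the coefficients. -/
def thomasonComplexIsoTensor :
    thomasonComplex A C ≅ tensorComplex A (simplexResolution C).complex :=
  NatIso.ofComponents thomasonComplexObjIsoTensor fun {T T'} τ => by
    refine HomologicalComplex.hom_ext _ _ fun n => ?_
    refine (_ ≫= thomasonComplexObjIsoTensor_hom_f T' n).trans ?_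
    refine Eq.trans ?_ (thomasonComplexObjIsoTensor_hom_f T n =≫
      tensorMapRight τ ((simplexRep C).obj (op ⦋n⦌))).symm
    exact coprodSimplicesDesc_comp_isoTensor (fun f => f) _ _ fun f => tensorι_mapRight _ _ _ _

variable (A C) in
/-- The isomorphism between Thomason homology and `Tor(ℤ, -)`. -/
def thomasonHomologyIsoTorZ (n : ℕ) : thomasonHomology A C n ≅ torZ A (SimplexOver C)ᵒᵖ n :=
  Functor.isoWhiskerRight (thomasonComplexIsoTensor A C) _ ≪≫
    (torZIso A (simplexResolution C) n).symm

lemma thomasonHomologyIsoTorZ_hom_app_comp_torZIso (T : (SimplexOver C)ᵒᵖ ⥤ A) (n : ℕ) :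
    (thomasonHomologyIsoTorZ A C n).hom.app T ≫ (torZIso A (simplexResolution C) n).hom.app T =
      (HomologicalComplex.homologyFunctor A _ n).map ((thomasonComplexIsoTensor A C).hom.app T) :=
  (Category.assoc _ _ _).trans
    ((_ ≫= Iso.inv_hom_id_app _ _).trans (Category.comp_id _))

end ThomasonTensor

section ThomasonChange

open AlgebraicTopology

open scoped Simplicial

variable {C C' : Type v} [SmallCategory.{v} C] [SmallCategory.{v} C'] (φ : C ⥤ C')

/-- The identification of `ℤ Hom_Δ([n], dim -)` on `Δ/C` with the restriction of the corresponding
functor on `Δ/C'`. -/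
def simplexRepChange : simplexRep C ⟶
    ((SimplicialObject.whiskering _ _).obj (restrictAb (SimplexOver.map φ).op)).obj
      (simplexRep C') where
  app n :=
    { app x := 𝟙 (((simplexRep C).obj n).obj x)
      naturality _ _ _ := (Category.comp_id _).trans (Category.id_comp _).symm }
  naturality n m a := by
    ext1
    ext1 x
    exact (Category.comp_id _).trans (Category.id_comp _).symm

/-- The identification of the simplex resolution on `Δ/C` with the restriction of the simplex
resolution on `Δ/C'`. -/
def simplexResolutionChange : (simplexResolution C).complex ⟶
    ((restrictAb (SimplexOver.map φ).op).mapHomologicalComplex _).obj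
      (simplexResolution C').complex :=
  (alternatingFaceMapComplex _).map (simplexRepChange φ) ≫
    (mapAlternatingFaceMapComplexIso (restrictAb (SimplexOver.map φ).op) (simplexRep C')).inv

lemma simplexResolutionChange_f (n : ℕ) :
    (simplexResolutionChange φ).f n = (simplexRepChange φ).app (op ⦋n⦌) :=
  (_ ≫= mapAlternatingFaceMapComplexIso_inv_f _ _ n).trans (Category.comp_id _)

lemma simplexResolutionChange_π :
    (simplexResolutionChange φ).f 0 ≫
        (restrictAb (SimplexOver.map φ).op).map ((simplexResolution C').π.f 0) =
      (simplexResolution C).π.f 0 := by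
  refine (congrArg₂ (· ≫ ·) (simplexResolutionChange_f φ 0)
    (congrArg (restrictAb (SimplexOver.map φ).op).map (simplexResolution_π_f_zero C'))).trans
      (Eq.trans ?_ (simplexResolution_π_f_zero C).symm)
  ext1
  ext1 x
  exact Category.id_comp _

variable {A : Type u} [Category.{v} A] [Abelian A] [HasColimits A] {φ}
  {T : (SimplexOver C)ᵒᵖ ⥤ A} {T' : (SimplexOver C')ᵒᵖ ⥤ A}
  (τ : T ⟶ (SimplexOver.map φ).op ⋙ T')

lemma thomasonComplexIsoTensor_change :
    (alternatingFaceMapComplex A).map (X := simplicialReplacementObj T)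
        (Y := simplicialReplacementObj T') (simplicialReplacementMap φ τ) ≫
        (thomasonComplexIsoTensor A C').hom.app T' =
      (thomasonComplexIsoTensor A C).hom.app T ≫
        tensorComplexMap (SimplexOver.map φ).op (simplexResolutionChange φ) τ := by
  refine HomologicalComplex.hom_ext _ _ fun n => ?_
  refine (_ ≫= thomasonComplexObjIsoTensor_hom_f T' n).trans ?_
  refine Eq.trans ?_ (congrArg₂ (· ≫ ·) (thomasonComplexObjIsoTensor_hom_f T n)
    (congrArg (tensorMapLeft T) (simplexResolutionChange_f φ n) =≫
      tensorChange (SimplexOver.map φ).op τ ((simplexRep C').obj (op ⦋n⦌)))).symm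
  exact coprodSimplicesDesc_comp_isoTensor _ _ _ fun f =>
    (tensorι_mapLeft_assoc T ((simplexRepChange φ).app _) _ _ _).trans
      (tensorι_change (SimplexOver.map φ).op τ ((simplexRep C').obj _) _ _)

lemma thomasonHomologyMap_thomasonHomologyIsoTorZ (n : ℕ) :
    thomasonHomologyMap φ τ n ≫ (thomasonHomologyIsoTorZ A C' n).hom.app T' =
      (thomasonHomologyIsoTorZ A C n).hom.app T ≫ torZMap (SimplexOver.map φ).op τ n := by
  let H := HomologicalComplex.homologyFunctor A (ComplexShape.down ℕ) n
  have hTor := torZMap_torZIso (simplexResolution C) (simplexResolution C')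
    (SimplexOver.map φ).op τ n (simplexResolutionChange_π φ)
  have hTh : thomasonHomologyMap φ τ n ≫ H.map ((thomasonComplexIsoTensor A C').hom.app T') =
      H.map ((thomasonComplexIsoTensor A C).hom.app T) ≫
        H.map (tensorComplexMap (SimplexOver.map φ).op (simplexResolutionChange φ) τ) :=
    (H.map_comp _ _).symm.trans
      ((H.congr_map (thomasonComplexIsoTensor_change τ)).trans (H.map_comp _ _))
  rw [← cancel_mono ((torZIso A (simplexResolution C') n).hom.app T'), Category.assoc,
    Category.assoc, hTor, thomasonHomologyIsoTorZ_hom_app_comp_torZIso,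
    reassoc_of% thomasonHomologyIsoTorZ_hom_app_comp_torZIso]
  exact hTh

end ThomasonChange

end Thomason

end

theorem mainTheorem2_general {A : Type u} [Category.{v} A] [Abelian A] [HasColimits A] :
    (∃ e : ∀ (C : Type v) [SmallCategory.{v} C] (n : ℕ),
      thomasonHomology A C n ≅ torZ A (SimplexOver C)ᵒᵖ n,
      ∀ (C C' : Type v) [SmallCategory.{v} C] [SmallCategory.{v} C'] (φ : C ⥤ C')
        (T : (SimplexOver C)ᵒᵖ ⥤ A) (T' : (SimplexOver C')ᵒᵖ ⥤ A)
        (τ : T ⟶ (SimplexOver.map φ).op ⋙ T') (n : ℕ),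
        thomasonHomologyMap φ τ n ≫ (e C' n).hom.app T' =
          (e C n).hom.app T ≫ torZMap (SimplexOver.map φ).op τ n) ∧
    ∀ [AB4 A], (∀ (I : Type v) [SmallCategory.{v} I], Nonempty (DerivedColimits A I)) ∧
      ∃ e' : ∀ (I : Type v) [SmallCategory.{v} I] (L : DerivedColimits A I) (n : ℕ),
        torZ A I n ≅ L.functor n,
        ∀ (I K : Type v) [SmallCategory.{v} I] [SmallCategory.{v} K] (L : DerivedColimits A I)
          (M : DerivedColimits A K) (w : I ⥤ K) (D : I ⥤ A) (E : K ⥤ A) (τ : D ⟶ w ⋙ E) (n : ℕ),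
          torZMap w τ n ≫ (e' K M n).hom.app E =
            (e' I L n).hom.app D ≫ derivedColimMap L M w τ n :=
  ⟨⟨fun C _ n => thomasonHomologyIsoTorZ A C n,
      fun _ _ _ _ _ _ _ τ n => thomasonHomologyMap_thomasonHomologyIsoTorZ τ n⟩,
    fun I _ => ⟨torDerivedColimits (projectiveResolution (constZ I))⟩,
    fun _ _ L n => torZIsoDerivedColim L n,
    fun _ _ _ _ L M w _ _ τ n => torZMap_torZIsoDerivedColim L M w τ n⟩

theorem mainTheorem2 {A : Type u} [Category.{v} A] [Abelian A] [HasColimits A] [AB4 A] :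
    ∃ e : ∀ (C : Type v) [SmallCategory.{v} C] (n : ℕ),
      thomasonHomology A C n ≅ torZ A (SimplexOver C)ᵒᵖ n,
    (∀ (C C' : Type v) [SmallCategory.{v} C] [SmallCategory.{v} C'] (φ : C ⥤ C')
      (T : (SimplexOver C)ᵒᵖ ⥤ A) (T' : (SimplexOver C')ᵒᵖ ⥤ A)
      (τ : T ⟶ (SimplexOver.map φ).op ⋙ T') (n : ℕ),
      thomasonHomologyMap φ τ n ≫ (e C' n).hom.app T' =
        (e C n).hom.app T ≫ torZMap (SimplexOver.map φ).op τ n) ∧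
    (∀ (C : Type v) [SmallCategory.{v} C], Nonempty (DerivedColimits A (SimplexOver C)ᵒᵖ)) ∧
    ∀ L : ∀ (C : Type v) [SmallCategory.{v} C], DerivedColimits A (SimplexOver C)ᵒᵖ,
      ∃ e' : ∀ (C : Type v) [SmallCategory.{v} C] (n : ℕ),
        torZ A (SimplexOver C)ᵒᵖ n ≅ (L C).functor n,
      ∀ (C C' : Type v) [SmallCategory.{v} C] [SmallCategory.{v} C'] (φ : C ⥤ C')
        (T : (SimplexOver C)ᵒᵖ ⥤ A) (T' : (SimplexOver C')ᵒᵖ ⥤ A)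
        (τ : T ⟶ (SimplexOver.map φ).op ⋙ T') (n : ℕ),
        torZMap (SimplexOver.map φ).op τ n ≫ (e' C' n).hom.app T' =
          (e' C n).hom.app T ≫ derivedColimMap (L C) (L C') (SimplexOver.map φ).op τ n :=
  let ⟨⟨e, he⟩, h⟩ := mainTheorem2_general (A := A)
  let ⟨hL, e', he'⟩ := h
  ⟨e, he, fun _ _ => hL _, fun L => ⟨fun C _ n => e' _ (L C) n, fun _ _ _ _ _ _ _ τ n =>
    he' _ _ (L _) (L _) _ _ _ τ n⟩⟩
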